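/- Let $N:\mathbb{R}\to\mathbb{R}$ be non-decreasing with $N(x)=0$ for $x<1$, and suppose that its zeta function $\zeta(s)=\int_{1^{-}}^{\infty}x^{-s}\,dN(x)$ converges for $\operatorname{Re} s>1$. Let $n\ge 0$ be an integer and $\beta>0$. Suppose that there are constants $a,r_1,\dots,r_n\in[0,\infty)$ and $\theta_1,\dots,\theta_n\in[0,2\pi)$ such that the function $$G(s)=\zeta(s)-\frac{a}{s-1}-s\sum_{j=1}^{n}\left(r_je^{i\theta_j}(s-1-i)^{j-\frac12}+r_je^{-i\theta_j}(s-1+i)^{j-\frac12}\right),\qquad \operatorname{Re} s>1$$ (principal branches of the powers), extends to an $n$ times continuously differentiable function on the closed half-plane $\operatorname{Re} s\ge 1$, and such that this extension satisfies $$\left|G^{(j)}(1+it)\right|=O\left(|t|^{\beta+n-j}\right),\qquad |t|\to\infty,\quad j=0,1,\dots,n.$$ Then $$N(x)=ax+\frac{2x}{\log^{1/2}x}\sum_{j=1}^{n}\frac{r_j\cos(\log x+\theta_j)}{\Gamma\left(-j+\frac12\right)\log^{j}x}+O\left(\frac{x}{\log^{n/(1+\beta)}x}\right),\qquad x\to\infty.$$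 -/

import Mathlib

noncomputable section

/-- The zeta function `ζ(s) = ∫_{1⁻}^∞ x ^ (-s) dN(x)` of a non-decreasing function `N`, as an
integral over `[1, ∞)` against the Lebesgue-Stieltjes measure of `N`. The atom at `1`, of mass
`N(1⁺) - N(1⁻)`, is included, as the lower limit `1⁻` demands. -/
def stieltjesZeta (N : ℝ → ℝ) (hN : Monotone N) (s : ℂ) : ℂ :=
  ∫ x in Set.Ici (1 : ℝ), (x : ℂ) ^ (-s) ∂hN.stieltjesFunction.measure

/-- The integral defining `ζ(s)` converges for every `s` with `Re s > 1`. (As `dN ≥ 0`, convergence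
in this open half-plane is the same as absolute convergence there.) -/
def StieltjesZetaConverges (N : ℝ → ℝ) (hN : Monotone N) : Prop :=
  ∀ s : ℂ, 1 < s.re →
    MeasureTheory.IntegrableOn (fun x : ℝ => (x : ℂ) ^ (-s)) (Set.Ici 1)
      hN.stieltjesFunction.measure

/-- `G(s) = ζ(s) - a / (s - 1)
  - s ∑_{j=1}^n (r_j e^{iθ_j} (s - 1 - i)^{j - 1/2} + r_j e^{-iθ_j} (s - 1 + i)^{j - 1/2})`,
with principal branches of the powers, which are continuous on `Re s ≥ 1`. -/
def zetaRemainder (N : ℝ → ℝ) (hN : Monotone N) (n : ℕ) (a : ℝ) (r θ : ℕ → ℝ) (s : ℂ) : ℂ :=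
  stieltjesZeta N hN s - a / (s - 1)
    - s * ∑ j ∈ Finset.Icc 1 n,
        (r j * Complex.exp (θ j * Complex.I) * (s - 1 - Complex.I) ^ ((j : ℂ) - 1 / 2)
          + r j * Complex.exp (-(θ j) * Complex.I) * (s - 1 + Complex.I) ^ ((j : ℂ) - 1 / 2))

/-- The closed half-plane `Re s ≥ 1`. -/
def closedHalfPlane : Set ℂ := {s | 1 ≤ s.re}

/-- `F` is an extension of `G`, given on `Re s > 1`, to an `n` times continuously differentiable
function on the closed half-plane `Re s ≥ 1`. -/
def IsCnExtension (n : ℕ) (G F : ℂ → ℂ) : Prop :=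
  ContDiffOn ℂ n F closedHalfPlane ∧ ∀ s : ℂ, 1 < s.re → F s = G s

end

/-! Put `T u = N (exp u) * exp (-u)`. By Fubini its Laplace transform is `ζ(1 + z) / (1 + z)` for
`Re z > 0`. The main term `b = scaledMainTerm` is chosen so that its transform has the same singular
part: `a * (1 - exp (-u))` gives `a / (z (1 + z))`, and the cosine waves give the powers `(z ∓ i)^(j
- 1/2)` up to entire errors, because the factor `s` in `G` cancels the denominator `1 + z`. Hence `Δ
= T - b` has a transform `H` that is continuous on `Re z ≥ 0`: it is `G(1 + z) / (1 + z)` minus a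
combination of entire functions.

Average `Δ` against `l * K (l * (x - u))`, where `K ≥ 0` decays rapidly and has a compactly
supported Fourier transform `χ`. The average equals `∫ χ(t/l) H(it) e^{itx} dt`. The growth
hypotheses make `G(1 + it) / (1 + it)` a symbol of order `β + n - 1`, so `n` integrations by parts
leave an integrand `O(|t|^(β-1))` on `|t| ≤ R l`, and the average is `O(l^β / x^n)`. The entire
errors are integrals of `e^{-zu}` over `0 ≤ u ≤ 1` with polynomial factors, whose frequency `x - u`
stays away from `0`, so they obey the same bound (`hasSmallOscillation_remainderLaplace`).

Monotonicity of `N` prevents `Δ` from falling faster than linearly. So a value `Δ x` persists, up to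
`O(1/l)`, on a window of length about `1/l` beside `x`, and the average controls it
(`tauberian_decay`). The errors `1/l` and `l^β / x^n` balance at `l = x^γ` with `γ = n / (1 + β)`,
which gives `Δ x = O(x^(-γ))`.

Evaluating the averages on the line `Re z = 0` requires `Δ` to be bounded. This is proved
beforehand, with `l = 1` and abscissas `σ > 0`, in `exists_bound_of_laplace_continuousOn`. -/

noncomputable section

/-! ### Symbol estimates and oscillatory integrals with a dilated cutoff. -/

/-- `g` is `m` times continuously differentiable and behaves, up to `m` derivatives, like a symbol
of order `p`. -/
def IsSymbol (m : ℕ) (p : ℝ) (g : ℝ → ℂ) : Prop :=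
  ContDiff ℝ m g ∧ ∃ C : ℝ, ∀ k ≤ m, ∀ t : ℝ, ‖iteratedDeriv k g t‖ ≤ C * (1 + |t|) ^ (p - k)

theorem IsSymbol.mono {m : ℕ} {p q : ℝ} {g : ℝ → ℂ} (hg : IsSymbol m p g) (hpq : p ≤ q) :
    IsSymbol m q g := by
  obtain ⟨hc, C, hC⟩ := hg
  refine ⟨hc, |C|, fun k hk t => (hC k hk t).trans ?_⟩
  have h1 : (1 : ℝ) ≤ 1 + |t| := by linarith [abs_nonneg t]
  have := Real.rpow_le_rpow_of_exponent_le h1 (sub_le_sub_right hpq (k : ℝ))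
  exact mul_le_mul (le_abs_self C) this (by positivity) (abs_nonneg C)

/-- Leibniz rule at a single point `t`; `2 ^ k` is the sum of the binomial coefficients. The
pointwise form lets `A` and `B` depend on `t`, so that `A` may later carry the indicator of the
support of the cutoff. -/
theorem norm_iteratedDeriv_mul_le_rpow {k : ℕ} {p q A B w t : ℝ} {f g : ℝ → ℂ} (hw : 0 < w)
    (hf : ContDiff ℝ k f) (hg : ContDiff ℝ k g)
    (hA : ∀ i ≤ k, ‖iteratedDeriv i f t‖ ≤ A * w ^ (p - i))
    (hB : ∀ i ≤ k, ‖iteratedDeriv i g t‖ ≤ B * w ^ (q - i)) :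
    ‖iteratedDeriv k (fun t => f t * g t) t‖ ≤ 2 ^ k * (A * B) * w ^ (p + q - k) := by
  have h1 := norm_iteratedFDeriv_mul_le (N := (k : ℕ∞)) hf hg t (n := k) le_rfl
  simp only [norm_iteratedFDeriv_eq_norm_iteratedDeriv] at h1
  have h2 : ∑ i ∈ Finset.range (k + 1), (k.choose i : ℝ) * ‖iteratedDeriv i f t‖ *
      ‖iteratedDeriv (k - i) g t‖ ≤ ∑ i ∈ Finset.range (k + 1), (k.choose i : ℝ) *
        ((A * B) * w ^ (p + q - k)) := by
    refine Finset.sum_le_sum fun i hi => ?_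
    have hik : i ≤ k := Nat.lt_succ_iff.mp (Finset.mem_range.mp hi)
    have e : w ^ (p + q - k) = w ^ (p - i) * w ^ (q - (k - i : ℕ)) := by
      rw [← Real.rpow_add hw]; congr 1; push_cast [hik]; ring
    have hprod : ‖iteratedDeriv i f t‖ * ‖iteratedDeriv (k - i) g t‖ ≤
        (A * w ^ (p - i)) * (B * w ^ (q - (k - i : ℕ))) :=
      mul_le_mul (hA i hik) (hB _ (Nat.sub_le _ _)) (norm_nonneg _)
        ((norm_nonneg _).trans (hA i hik))
    rw [e, mul_assoc]
    calc _ ≤ (k.choose i : ℝ) * ((A * w ^ (p - i)) * (B * w ^ (q - (k - i : ℕ)))) := by gcongr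
      _ = _ := by ring
  refine h1.trans (h2.trans (le_of_eq ?_))
  rw [← Finset.sum_mul, ← Nat.cast_sum, Nat.sum_range_choose]
  push_cast; ring

theorem IsSymbol.mul {m : ℕ} {p q : ℝ} {f g : ℝ → ℂ} (hf : IsSymbol m p f) (hg : IsSymbol m q g) :
    IsSymbol m (p + q) (fun t => f t * g t) := by
  obtain ⟨hfc, A, hA⟩ := hf
  obtain ⟨hgc, B, hB⟩ := hg
  refine ⟨hfc.mul hgc, 2 ^ m * (|A| * |B|), fun k hk t => ?_⟩
  have h0 : (0 : ℝ) < 1 + |t| := by linarith [abs_nonneg t]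
  have hkm : ((k : ℕ) : WithTop ℕ∞) ≤ m := by exact_mod_cast hk
  refine (norm_iteratedDeriv_mul_le_rpow h0 (hfc.of_le hkm) (hgc.of_le hkm)
    (A := |A|) (B := |B|) (p := p) (q := q)
    (fun i hi => (hA i (hi.trans hk) t).trans (by gcongr; exact le_abs_self A))
    (fun i hi => (hB i (hi.trans hk) t).trans (by gcongr; exact le_abs_self B))).trans ?_
  gcongr
  norm_num

theorem isSymbol_one (m : ℕ) : IsSymbol m 0 (fun _ => 1) := by
  refine ⟨contDiff_const, 1, fun k _ t => ?_⟩
  have h0 : (0 : ℝ) < 1 + |t| := by linarith [abs_nonneg t]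
  rcases Nat.eq_zero_or_pos k with rfl | hk
  · simp
  · rw [iteratedDeriv_const, if_neg hk.ne']
    simpa using by positivity

theorem isSymbol_affine (m : ℕ) (τ : ℝ) :
    IsSymbol m 1 (fun t : ℝ => Complex.I * ((t : ℂ) - τ)) := by
  refine ⟨contDiff_const.mul (Complex.ofRealCLM.contDiff.sub contDiff_const), 1 + |τ|, fun k _ t => ?_⟩
  have h0 : (0 : ℝ) < 1 + |t| := by linarith [abs_nonneg t]
  have hd : deriv (fun t : ℝ => Complex.I * ((t : ℂ) - τ)) = fun _ => Complex.I := by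
    funext t
    simpa using (((Complex.ofRealCLM.hasDerivAt (x := t)).sub_const (τ : ℂ)).const_mul
      Complex.I).deriv
  rcases k with _ | _ | k
  · simp only [iteratedDeriv_zero, norm_mul, Complex.norm_I, one_mul, Nat.cast_zero, sub_zero,
      Real.rpow_one, ← Complex.ofReal_sub, Complex.norm_real, Real.norm_eq_abs]
    have := abs_sub t τ
    nlinarith [abs_nonneg t, abs_nonneg τ]
  · rw [iteratedDeriv_one, hd]; simp
  · rw [iteratedDeriv_succ', hd, iteratedDeriv_const, if_neg (Nat.succ_ne_zero k)]
    simpa using by positivity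

theorem IsSymbol.pow {m : ℕ} {p : ℝ} {f : ℝ → ℂ} (hf : IsSymbol m p f) (k : ℕ) :
    IsSymbol m (k * p) (fun t => f t ^ k) := by
  induction k with
  | zero => simpa using isSymbol_one m
  | succ k ih =>
    have := ih.mul hf
    simp only [pow_succ]
    convert this using 1
    push_cast; ring

theorem one_add_mul_I_ne_zero (t : ℝ) : (1 : ℂ) + t * Complex.I ≠ 0 := by
  intro h
  have := congrArg Complex.re h
  simp at this

theorem one_add_abs_le_two_mul_norm (t : ℝ) : 1 + |t| ≤ 2 * ‖(1 : ℂ) + t * Complex.I‖ := by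
  have h1 := Complex.abs_re_le_norm ((1 : ℂ) + t * Complex.I)
  have h2 := Complex.abs_im_le_norm ((1 : ℂ) + t * Complex.I)
  simp only [Complex.add_re, Complex.one_re, Complex.mul_re, Complex.ofReal_re, Complex.I_re, mul_zero, Complex.ofReal_im, Complex.I_im, mul_one, sub_self, add_zero, abs_one, Complex.add_im, Complex.one_im, Complex.mul_im, zero_add] at h1 h2
  linarith

theorem iteratedDeriv_inv_one_add_mul_I (k : ℕ) :
    iteratedDeriv k (fun t : ℝ => ((1 : ℂ) + t * Complex.I)⁻¹) =
      fun t : ℝ => (-Complex.I) ^ k * (k.factorial : ℂ) * (((1 : ℂ) + t * Complex.I)⁻¹) ^ (k + 1) := by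
  induction k with
  | zero => simp
  | succ k ih =>
    rw [iteratedDeriv_succ, ih]
    funext t
    have hne := one_add_mul_I_ne_zero t
    have h1 : HasDerivAt (fun t : ℝ => (1 : ℂ) + t * Complex.I) Complex.I t := by
      simpa using ((Complex.ofRealCLM.hasDerivAt (x := t)).mul_const Complex.I).const_add 1
    have h2 := ((h1.fun_inv hne).fun_pow (k + 1)).const_mul ((-Complex.I) ^ k * (k.factorial : ℂ))
    rw [h2.deriv]
    push_cast [Nat.factorial_succ]
    rw [div_eq_mul_inv, ← inv_pow]
    ring

theorem isSymbol_inv_one_add_mul_I (m : ℕ) :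
    IsSymbol m (-1) (fun t : ℝ => ((1 : ℂ) + t * Complex.I)⁻¹) := by
  refine ⟨?_, ∑ k ∈ Finset.range (m + 1), (k.factorial : ℝ) * 2 ^ (k + 1), fun k hk t => ?_⟩
  · refine ContDiff.inv ?_ one_add_mul_I_ne_zero
    exact contDiff_const.add (Complex.ofRealCLM.contDiff.mul contDiff_const)
  · have h0 : (0 : ℝ) < 1 + |t| := by linarith [abs_nonneg t]
    have e : (1 + |t|) ^ (-1 - k : ℝ) = ((1 + |t|)⁻¹) ^ (k + 1) := by
      rw [inv_pow, ← Real.rpow_natCast, ← Real.rpow_neg h0.le]; congr 1; push_cast; ring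
    rw [iteratedDeriv_inv_one_add_mul_I, e]
    simp only [norm_mul, norm_pow, norm_neg, Complex.norm_I, one_pow, one_mul, norm_inv,
      Complex.norm_natCast]
    have h3 : ‖(1 : ℂ) + t * Complex.I‖⁻¹ ≤ 2 * (1 + |t|)⁻¹ := by
      have := one_add_abs_le_two_mul_norm t
      have hp : 0 < ‖(1 : ℂ) + t * Complex.I‖ := norm_pos_iff.mpr (one_add_mul_I_ne_zero t)
      rw [← div_eq_mul_inv, le_div_iff₀ h0, inv_mul_le_iff₀ hp]
      linarith
    calc (k.factorial : ℝ) * ‖(1 : ℂ) + t * Complex.I‖⁻¹ ^ (k + 1)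
        ≤ k.factorial * (2 * (1 + |t|)⁻¹) ^ (k + 1) := by gcongr
      _ = (k.factorial * 2 ^ (k + 1)) * (1 + |t|)⁻¹ ^ (k + 1) := by rw [mul_pow]; ring
      _ ≤ _ := by
        gcongr
        exact Finset.single_le_sum (f := fun k : ℕ => (k.factorial : ℝ) * 2 ^ (k + 1))
          (fun k _ => by positivity) (Finset.mem_range.mpr (by omega))

/-- Each integration by parts moves one factor `i v` onto a derivative of `f`. Keeping `|v| ^ m` on
the left avoids a separate case `v = 0`. -/
theorem norm_integral_mul_exp_mul_pow_le (m : ℕ) (f : ℝ → ℂ) (hf : ContDiff ℝ m f)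
    (hc : HasCompactSupport f) (v : ℝ) :
    ‖∫ t : ℝ, f t * Complex.exp (Complex.I * t * v)‖ * |v| ^ m ≤ ∫ t, ‖iteratedDeriv m f t‖ := by
  induction m generalizing f with
  | zero =>
    simp only [pow_zero, mul_one, iteratedDeriv_zero]
    refine (MeasureTheory.norm_integral_le_integral_norm _).trans (le_of_eq ?_)
    congr 1; funext t
    rw [norm_mul, show Complex.I * t * v = ((t * v : ℝ) : ℂ) * Complex.I by push_cast; ring,
      Complex.norm_exp_ofReal_mul_I, mul_one]
  | succ m ih =>
    have hd : Differentiable ℝ f := hf.differentiable (by simp)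
    have hd' : ContDiff ℝ m (deriv f) := by
      exact (contDiff_succ_iff_deriv (n := m).mp (by exact_mod_cast hf)).2.2
    have h1 := ih (deriv f) hd' hc.deriv
    rw [iteratedDeriv_succ']
    refine le_trans (le_of_eq ?_) h1
    have he : ∀ t : ℝ, HasDerivAt (fun t : ℝ => Complex.exp (Complex.I * t * v))
        (Complex.exp (Complex.I * t * v) * (Complex.I * v)) t := by
      intro t
      have : HasDerivAt (fun t : ℝ => Complex.I * (t : ℂ) * v) (Complex.I * v) t := by
        simpa using ((Complex.ofRealCLM.hasDerivAt (x := t)).const_mul Complex.I).mul_const (v : ℂ)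
      exact this.cexp
    have hce : Continuous fun t : ℝ => Complex.exp (Complex.I * t * v) := by fun_prop
    have key := MeasureTheory.integral_mul_deriv_eq_deriv_mul_of_integrable
      (u := f) (u' := deriv f) (fun t _ => (hd t).hasDerivAt) (fun t _ => he t)
      ((hf.continuous.mul (hce.mul continuous_const)).integrable_of_hasCompactSupport hc.mul_right)
      ((hd'.continuous.mul hce).integrable_of_hasCompactSupport hc.deriv.mul_right)
      ((hf.continuous.mul hce).integrable_of_hasCompactSupport hc.mul_right)
    have e2 : ∫ t : ℝ, f t * (Complex.exp (Complex.I * t * v) * (Complex.I * v)) =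
        (∫ t : ℝ, f t * Complex.exp (Complex.I * t * v)) * (Complex.I * v) := by
      rw [← MeasureTheory.integral_mul_const]; congr 1; funext t; ring
    rw [e2] at key
    have := congrArg norm key
    rw [norm_neg, norm_mul, norm_mul, Complex.norm_I, one_mul, Complex.norm_real,
      Real.norm_eq_abs] at this
    rw [← this]; ring


theorem integral_indicator_one_add_abs_rpow_le {β : ℝ} (hβ : 0 < β) {T : ℝ} (hT : 0 ≤ T) :
    MeasureTheory.Integrable
        ((Set.Icc (-T) T).indicator fun t : ℝ => (1 + |t|) ^ (β - 1)) ∧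
      ∫ t, (Set.Icc (-T) T).indicator (fun t : ℝ => (1 + |t|) ^ (β - 1)) t
        ≤ 2 / β * (1 + T) ^ β := by
  have hcont : Continuous fun t : ℝ => (1 + |t|) ^ (β - 1) :=
    (continuous_const.add continuous_abs).rpow_const fun t =>
      Or.inl (by positivity : 1 + |t| ≠ 0)
  refine ⟨(hcont.integrableOn_Icc).integrable_indicator measurableSet_Icc, ?_⟩
  have e1 : ∀ t : ℝ, (Set.Icc (-T) T).indicator (fun t : ℝ => (1 + |t|) ^ (β - 1)) t =
      (fun s : ℝ => (Set.Iic T).indicator (fun s : ℝ => (1 + s) ^ (β - 1)) s) |t| := by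
    intro t
    change _ = (Set.Iic T).indicator (fun s : ℝ => (1 + s) ^ (β - 1)) |t|
    by_cases h : |t| ≤ T
    · rw [Set.indicator_of_mem (Set.mem_Icc.mpr (abs_le.mp h)), Set.indicator_of_mem (show |t| ∈ Set.Iic T from h)]
    · rw [Set.indicator_of_notMem (fun h' : t ∈ Set.Icc (-T) T => h (abs_le.mpr h')),
        Set.indicator_of_notMem (show |t| ∉ Set.Iic T from h)]
  simp_rw [e1]
  rw [integral_comp_abs (f := fun s : ℝ => (Set.Iic T).indicator (fun s : ℝ => (1 + s) ^ (β - 1)) s),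
    MeasureTheory.setIntegral_indicator measurableSet_Iic, Set.Ioi_inter_Iic,
    ← intervalIntegral.integral_of_le hT,
    intervalIntegral.integral_comp_add_left (fun s : ℝ => s ^ (β - 1)) 1,
    integral_rpow (Or.inl (by linarith))]
  simp only [sub_add_cancel, add_zero, Real.one_rpow]
  rw [div_mul_eq_mul_div, mul_div_assoc]
  gcongr
  linarith

/-- The dilated cutoffs are symbols of order `0` uniformly in `l`: each derivative costs `l⁻¹`, and
on the support `|t| ≤ R l` one has `l⁻¹ ≤ (1 + R) / (1 + |t|)`. -/
theorem exists_bound_iteratedDeriv_dilation {χ : ℝ → ℂ} (hχ : ContDiff ℝ (⊤ : ℕ∞) χ)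
    (hc : HasCompactSupport χ) (m : ℕ) :
    ∃ R : ℝ, 0 ≤ R ∧ ∃ A : ℝ, 0 ≤ A ∧ ∀ l : ℝ, 1 ≤ l → ∀ i ≤ m, ∀ t : ℝ,
      ‖iteratedDeriv i (fun t => χ (l⁻¹ * t)) t‖ ≤
        (Set.Icc (-(R * l)) (R * l)).indicator (fun _ => A) t * (1 + |t|) ^ ((0 : ℝ) - i) := by
  obtain ⟨R, hR⟩ := hc.isCompact.isBounded.subset_closedBall 0
  have hb : ∀ i : ℕ, ∃ M : ℝ, ∀ t, ‖iteratedDeriv i χ t‖ ≤ M := by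
    intro i
    have h1 : Continuous (iteratedDeriv i χ) := hχ.continuous_iteratedDeriv i (by exact_mod_cast le_top)
    have h2 : HasCompactSupport (iteratedDeriv i χ) := by
      have := hc.iteratedFDeriv (𝕜 := ℝ) i
      refine this.mono' (subset_trans (fun x hx => ?_) subset_closure)
      rw [Function.mem_support] at hx ⊢
      rwa [← norm_ne_zero_iff, norm_iteratedFDeriv_eq_norm_iteratedDeriv, norm_ne_zero_iff]
    exact h2.exists_bound_of_continuous h1
  choose M hM using hb
  have hM0 : ∀ i, 0 ≤ M i := fun i => (norm_nonneg _).trans (hM i 0)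
  refine ⟨|R|, abs_nonneg R, (∑ i ∈ Finset.range (m + 1), M i) * (1 + |R|) ^ m,
    mul_nonneg (Finset.sum_nonneg fun i _ => hM0 i) (by positivity), fun l hl i hi t => ?_⟩
  have hl0 : 0 < l := by linarith
  have hw : 0 < 1 + |t| := by positivity
  rw [iteratedDeriv_comp_const_smul (hχ.of_le (by exact_mod_cast le_top)) l⁻¹]
  simp only [norm_smul, norm_pow, norm_inv, Real.norm_eq_abs, abs_of_pos hl0]
  by_cases ht : t ∈ Set.Icc (-(|R| * l)) (|R| * l)
  · rw [Set.indicator_of_mem ht]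
    have h1 : 1 + |t| ≤ (1 + |R|) * l := by
      have := abs_le.mpr ht
      linarith
    have h2 : l⁻¹ ≤ (1 + |R|) * (1 + |t|)⁻¹ := by
      rw [← div_eq_mul_inv, le_div_iff₀ hw, inv_mul_le_iff₀ hl0]
      linarith
    have e : (1 + |t|) ^ ((0 : ℝ) - i) = ((1 + |t|)⁻¹) ^ i := by
      rw [inv_pow, ← Real.rpow_natCast, ← Real.rpow_neg hw.le]; congr 1; ring
    rw [e]
    calc l⁻¹ ^ i * ‖iteratedDeriv i χ (l⁻¹ * t)‖
        ≤ ((1 + |R|) * (1 + |t|)⁻¹) ^ i * ∑ i ∈ Finset.range (m + 1), M i := by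
          gcongr
          exact (hM i _).trans (Finset.single_le_sum (fun i _ => hM0 i)
            (Finset.mem_range.mpr (by omega)))
      _ = (∑ i ∈ Finset.range (m + 1), M i) * (1 + |R|) ^ i * (1 + |t|)⁻¹ ^ i := by
          rw [mul_pow]; ring
      _ ≤ _ := by
          have := Finset.sum_nonneg fun i (_ : i ∈ Finset.range (m + 1)) => hM0 i
          gcongr
          linarith [abs_nonneg R]
  · rw [Set.indicator_of_notMem ht, zero_mul]
    have h0 : iteratedDeriv i χ (l⁻¹ * t) = 0 := by
      rw [← norm_eq_zero, ← norm_iteratedFDeriv_eq_norm_iteratedDeriv, norm_eq_zero]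
      by_contra hne
      have h1 := hR (support_iteratedFDeriv_subset (𝕜 := ℝ) i (Function.mem_support.mpr hne))
      rw [mem_closedBall_zero_iff, Real.norm_eq_abs, abs_mul, abs_of_pos (inv_pos.mpr hl0),
        inv_mul_le_iff₀ hl0] at h1
      exact ht (abs_le.mp (h1.trans (by rw [mul_comm]; gcongr; exact le_abs_self R)))
    rw [h0]; simp

/-- Oscillatory integrals of symbols against a dilated smooth cutoff. -/
theorem IsSymbol.exists_norm_integral_cutoff_le {χ : ℝ → ℂ} (hχ : ContDiff ℝ (⊤ : ℕ∞) χ)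
    (hc : HasCompactSupport χ) {m : ℕ} {β : ℝ} (hβ : 0 < β) {g : ℝ → ℂ}
    (hg : IsSymbol m (β + m - 1) g) :
    ∃ C : ℝ, 0 ≤ C ∧ ∀ l : ℝ, 1 ≤ l → ∀ v : ℝ,
      ‖∫ t : ℝ, χ (l⁻¹ * t) * g t * Complex.exp (Complex.I * t * v)‖ * |v| ^ m ≤ C * l ^ β := by
  obtain ⟨hgc, B, hB⟩ := hg
  obtain ⟨R, hR, A, hA0, hA⟩ := exists_bound_iteratedDeriv_dilation hχ hc m
  have hB0 : 0 ≤ B := by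
    have := (norm_nonneg _).trans (hB 0 (Nat.zero_le _) 0)
    simpa using this
  refine ⟨2 ^ m * (A * B) * (2 / β * (1 + R) ^ β), by positivity, fun l hl v => ?_⟩
  have hl0 : 0 < l := by linarith
  have hχl : ContDiff ℝ m (fun t : ℝ => χ (l⁻¹ * t)) :=
    (hχ.of_le (by exact_mod_cast le_top)).comp (contDiff_const.mul contDiff_id)
  have hcl : HasCompactSupport (fun t : ℝ => χ (l⁻¹ * t)) :=
    hc.comp_homeomorph (Homeomorph.mulLeft₀ l⁻¹ (inv_ne_zero hl0.ne'))
  refine (norm_integral_mul_exp_mul_pow_le m _ (hχl.mul hgc) hcl.mul_right v).trans ?_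
  obtain ⟨hi, hle⟩ := integral_indicator_one_add_abs_rpow_le hβ (T := R * l) (by positivity)
  -- Order `β + m - 1` minus `m` derivatives leaves the exponent `β - 1`, whose integral over `|t| ≤
  -- R l` is `O(l ^ β)` because `β > 0`.
  have hpt : ∀ t : ℝ, ‖iteratedDeriv m (fun t => χ (l⁻¹ * t) * g t) t‖ ≤ 2 ^ m * (A * B) *
      (Set.Icc (-(R * l)) (R * l)).indicator (fun t : ℝ => (1 + |t|) ^ (β - 1)) t := by
    intro t
    refine (norm_iteratedDeriv_mul_le_rpow (by positivity) hχl hgc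
      (fun i hi => hA l hl i hi t) (fun i hi => hB i hi t)).trans (le_of_eq ?_)
    by_cases ht : t ∈ Set.Icc (-(R * l)) (R * l)
    · rw [Set.indicator_of_mem ht, Set.indicator_of_mem ht]
      congr 2; ring
    · rw [Set.indicator_of_notMem ht, Set.indicator_of_notMem ht]; ring
  calc ∫ t, ‖iteratedDeriv m (fun t => χ (l⁻¹ * t) * g t) t‖
      ≤ ∫ t, 2 ^ m * (A * B) *
        (Set.Icc (-(R * l)) (R * l)).indicator (fun t : ℝ => (1 + |t|) ^ (β - 1)) t :=
        MeasureTheory.integral_mono_of_nonneg (Filter.Eventually.of_forall fun _ => norm_nonneg _)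
          (hi.const_mul _) (Filter.Eventually.of_forall hpt)
    _ ≤ 2 ^ m * (A * B) * (2 / β * (1 + R * l) ^ β) := by
        rw [MeasureTheory.integral_const_mul]; gcongr
    _ ≤ 2 ^ m * (A * B) * (2 / β * ((1 + R) * l) ^ β) := by
        gcongr; nlinarith
    _ = _ := by rw [Real.mul_rpow (by positivity) hl0.le]; ring

end

/-! ### The band-limited kernel. -/

noncomputable section

open scoped Convolution FourierTransform in
/-- A nonnegative, rapidly decreasing kernel whose Fourier transform is smooth with compact
support. -/
theorem exists_bandlimited_kernel : ∃ (χ : ℝ → ℂ) (K : ℝ → ℝ),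
    ContDiff ℝ (⊤ : ℕ∞) χ ∧ HasCompactSupport χ ∧ Continuous K ∧ (∀ v, 0 ≤ K v) ∧ 0 < K 0 ∧
    (∀ v : ℝ, (K v : ℂ) = ∫ t : ℝ, χ t * Complex.exp (Complex.I * t * v)) ∧
    ∀ γ : ℝ, MeasureTheory.Integrable fun v => (1 + 2 * |v|) ^ γ * K v := by
  let φ₀ : ContDiffBump (0 : ℝ) := ⟨1, 2, one_pos, one_lt_two⟩
  let φ : ℝ → ℂ := fun t => (φ₀ t : ℂ)
  have hφ : ContDiff ℝ (⊤ : ℕ∞) φ := Complex.ofRealCLM.contDiff.comp φ₀.contDiff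
  have hφc : HasCompactSupport φ := φ₀.hasCompactSupport.comp_left (g := ((↑) : ℝ → ℂ)) rfl
  have hφi : MeasureTheory.Integrable φ := hφ.continuous.integrable_of_hasCompactSupport hφc
  -- The transform of a self-convolution is a square; it is nonnegative once the transform `ψ` of
  -- `φ` is real.
  let χ : ℝ → ℂ := φ ⋆[ContinuousLinearMap.mul ℝ ℂ, MeasureTheory.volume] φ
  have hχ : ContDiff ℝ (⊤ : ℕ∞) χ := hφc.contDiff_convolution_right _ hφi.locallyIntegrable hφ
  have hχc : HasCompactSupport χ := hφc.convolution _ hφc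
  have hF : ∀ (f : ℝ → ℂ) (v : ℝ),
      ∫ t : ℝ, f t * Complex.exp (Complex.I * t * v) = 𝓕 f (-v / (2 * Real.pi)) := by
    intro f v
    rw [Real.fourier_real_eq_integral_exp_smul]
    congr 1; funext t
    rw [smul_eq_mul, mul_comm]
    congr 2
    have : (Real.pi : ℂ) ≠ 0 := by exact_mod_cast Real.pi_ne_zero
    push_cast
    field_simp
  let ψ : ℝ → ℂ := fun v => ∫ t : ℝ, φ t * Complex.exp (Complex.I * t * v)
  -- The bump is real and even, so conjugation followed by `t ↦ -t` fixes the integral.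
  have hψ : ∀ v, ψ v = (((ψ v).re : ℝ) : ℂ) := by
    intro v
    rw [eq_comm, ← Complex.conj_eq_iff_re]
    change (starRingEnd ℂ) (∫ t : ℝ, φ t * Complex.exp (Complex.I * t * v)) =
      ∫ t : ℝ, φ t * Complex.exp (Complex.I * t * v)
    rw [← integral_conj, ← MeasureTheory.integral_neg_eq_self]
    congr 1; funext t
    simp only [map_mul, ← Complex.exp_conj, φ, Complex.conj_ofReal, Complex.conj_I, φ₀.neg]
    push_cast
    ring_nf
  have hconv : ∀ v : ℝ, ∫ t : ℝ, χ t * Complex.exp (Complex.I * t * v) = ψ v * ψ v := by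
    intro v
    change _ = (∫ t : ℝ, φ t * Complex.exp (Complex.I * t * v)) *
      (∫ t : ℝ, φ t * Complex.exp (Complex.I * t * v))
    rw [hF, hF]
    exact Real.fourier_mul_convolution_eq hφi hφi _
  have hK : ∀ v : ℝ, (((ψ v).re ^ 2 : ℝ) : ℂ) = ∫ t : ℝ, χ t * Complex.exp (Complex.I * t * v) := by
    intro v
    rw [hconv, hψ v]; push_cast; simp only [Complex.ofReal_re]; ring
  have hnorm : ∀ f : ℝ → ℂ, ∀ t v : ℝ, ‖f t * Complex.exp (Complex.I * t * v)‖ = ‖f t‖ := by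
    intro f t v
    rw [norm_mul, show Complex.I * t * v = ((t * v : ℝ) : ℂ) * Complex.I by push_cast; ring,
      Complex.norm_exp_ofReal_mul_I, mul_one]
  have hψcont : Continuous ψ := by
    refine MeasureTheory.continuous_of_dominated (bound := fun t => ‖φ t‖) (fun v => ?_)
      (fun v => Filter.Eventually.of_forall fun t => (hnorm φ t v).le) hφi.norm
      (Filter.Eventually.of_forall fun t => by fun_prop)
    exact (hφ.continuous.mul (by fun_prop)).aestronglyMeasurable
  have hKcont : Continuous fun v => (ψ v).re ^ 2 := (Complex.continuous_re.comp hψcont).pow 2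
  refine ⟨χ, fun v => (ψ v).re ^ 2, hχ, hχc, hKcont, fun v => sq_nonneg _, ?_, hK, fun γ => ?_⟩
  · have h0 : ψ 0 = ((∫ t, φ₀ t : ℝ) : ℂ) := by
      rw [← integral_complex_ofReal]
      simp [ψ, φ]
    have := φ₀.integral_pos (μ := MeasureTheory.volume)
    simp only [h0, Complex.ofReal_re]
    positivity
  · obtain ⟨k, hk⟩ := exists_nat_ge γ
    have hdecay : ∀ m : ℕ, ∀ v : ℝ, (ψ v).re ^ 2 * |v| ^ m ≤ ∫ t, ‖iteratedDeriv m χ t‖ := by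
      intro m v
      have := norm_integral_mul_exp_mul_pow_le m χ (hχ.of_le (by exact_mod_cast le_top)) hχc v
      rwa [← hK, Complex.norm_real, Real.norm_eq_abs, abs_of_nonneg (sq_nonneg _)] at this
    -- `C₀` bounds the kernel near `0` and `C₁` bounds it times `|v| ^ (k + 2)`: `k` powers absorb
    -- the weight, since `γ ≤ k`, and two more leave the integrable function `1 / (1 + v ^ 2)`.
    set C₀ := ∫ t, ‖iteratedDeriv 0 χ t‖
    set C₁ := ∫ t, ‖iteratedDeriv (k + 2) χ t‖
    refine ((integrable_inv_one_add_sq).const_mul (3 ^ k * (2 * (C₀ + C₁)))).mono'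
      (Continuous.aestronglyMeasurable (Continuous.mul
        (Continuous.rpow_const (by fun_prop)
          fun v => Or.inl (by positivity : 1 + 2 * |v| ≠ 0)) hKcont))
      (Filter.Eventually.of_forall fun v => ?_)
    have hp : 0 < 1 + 2 * |v| := by positivity
    rw [Real.norm_eq_abs, abs_of_nonneg (by positivity), ← div_eq_mul_inv,
      le_div_iff₀ (by positivity)]
    have h1 : (1 + 2 * |v|) ^ γ ≤ (1 + 2 * |v|) ^ k := by
      rw [← Real.rpow_natCast]
      exact Real.rpow_le_rpow_of_exponent_le (by linarith [abs_nonneg v]) hk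
    have h2 : (1 + 2 * |v|) ^ k ≤ 3 ^ k * (max 1 |v|) ^ k := by
      rw [← mul_pow]
      gcongr
      linarith [le_max_left 1 |v|, le_max_right 1 |v|]
    have h3 : 1 + v ^ 2 ≤ 2 * (max 1 |v|) ^ 2 := by
      rw [← sq_abs v]
      have a1 : (1:ℝ) ^ 2 ≤ (max 1 |v|) ^ 2 := by gcongr; exact le_max_left _ _
      have a2 : |v| ^ 2 ≤ (max 1 |v|) ^ 2 := by gcongr; exact le_max_right _ _
      linarith
    have h4 : (ψ v).re ^ 2 * (max 1 |v|) ^ (k + 2) ≤ C₀ + C₁ := by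
      have b0 := hdecay 0 v
      have b1 := hdecay (k + 2) v
      have p0 : 0 ≤ (ψ v).re ^ 2 * |v| ^ (k + 2) := by positivity
      have p1 : 0 ≤ (ψ v).re ^ 2 := by positivity
      rcases le_total 1 |v| with h | h
      · rw [max_eq_right h]; rw [pow_zero, mul_one] at b0; linarith
      · rw [max_eq_left h]; rw [pow_zero, mul_one] at b0; rw [one_pow, mul_one]; linarith
    calc (1 + 2 * |v|) ^ γ * (ψ v).re ^ 2 * (1 + v ^ 2)
        ≤ (3 ^ k * (max 1 |v|) ^ k) * (ψ v).re ^ 2 * (2 * (max 1 |v|) ^ 2) := by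
          gcongr; exact h1.trans h2
      _ = 3 ^ k * (2 * ((ψ v).re ^ 2 * (max 1 |v|) ^ (k + 2))) := by rw [pow_add]; ring
      _ ≤ _ := by gcongr

end

/-! ### The zeta function as a Laplace transform. -/

noncomputable section

open MeasureTheory Set Filter Topology

theorem Monotone.stieltjesFunction_eq_of_continuousAt {N : ℝ → ℝ} (hN : Monotone N) {x : ℝ}
    (hx : ContinuousAt N x) : hN.stieltjesFunction x = N x := by
  rw [hN.stieltjesFunction_eq]
  exact rightLim_eq_of_tendsto (hx.tendsto.mono_left nhdsWithin_le_nhds)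

theorem Monotone.stieltjesFunction_eq_zero {N : ℝ → ℝ} (hN : Monotone N)
    (h0 : ∀ x < 1, N x = 0) {x : ℝ} (hx : x < 1) : hN.stieltjesFunction x = 0 := by
  rw [hN.stieltjesFunction_eq_of_continuousAt, h0 x hx]
  refine (continuousAt_const (y := (0:ℝ))).congr ?_
  filter_upwards [Iio_mem_nhds hx] with y hy using (h0 y hy).symm

/-- The left limit at `1` vanishes, so the atom at `1` is counted in full. -/
theorem Monotone.stieltjesFunction_measure_Icc_one {N : ℝ → ℝ} (hN : Monotone N)
    (h0 : ∀ x < 1, N x = 0) (y : ℝ) :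
    hN.stieltjesFunction.measure (Icc 1 y) = ENNReal.ofReal (hN.stieltjesFunction y) := by
  rw [StieltjesFunction.measure_Icc]
  have : Function.leftLim hN.stieltjesFunction 1 = 0 := by
    refine leftLim_eq_of_tendsto ?_
    refine tendsto_const_nhds.congr' ?_
    filter_upwards [self_mem_nhdsWithin] with x hx using
      (hN.stieltjesFunction_eq_zero h0 hx).symm
  rw [this, sub_zero]

theorem Monotone.ae_stieltjesFunction_exp_eq {N : ℝ → ℝ} (hN : Monotone N) :
    ∀ᵐ u : ℝ, hN.stieltjesFunction (Real.exp u) = N (Real.exp u) := by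
  have hc := (hN.countable_not_continuousAt.preimage Real.exp_injective).ae_notMem volume
  filter_upwards [hc] with u hu
  simp only [mem_preimage, mem_ofPred_eq, not_not] at hu
  exact hN.stieltjesFunction_eq_of_continuousAt hu

theorem Monotone.nonneg_of_eq_zero {N : ℝ → ℝ} (hN : Monotone N) (h0 : ∀ x < 1, N x = 0) (x : ℝ) :
    0 ≤ N x := by
  rcases lt_or_ge x 1 with h | h
  · rw [h0 x h]
  · rw [← h0 0 one_pos]; exact hN (by linarith)

/-- Fubini for `e^{-su}` on the region `x ≤ e^u` under `dN(x) du`: integrating over `u` first gives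
`x^{-s} / s`, integrating over `x` first gives `N(e^u) e^{-su}`. The latter holds for almost every
`u`, since `N` and its right-continuous version differ only at countably many points. -/
theorem hasLaplace_of_stieltjesZeta {N : ℝ → ℝ} (hN : Monotone N) (h0 : ∀ x < 1, N x = 0)
    (hconv : StieltjesZetaConverges N hN) {s : ℂ} (hs : 1 < s.re) :
    IntegrableOn (fun u : ℝ => (N (Real.exp u) : ℂ) * Complex.exp (-s * u)) (Ioi 0) ∧
      ∫ u in Ioi (0 : ℝ), (N (Real.exp u) : ℂ) * Complex.exp (-s * u) =
        stieltjesZeta N hN s / s := by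
  have hs0 : s ≠ 0 := fun h => by rw [h, Complex.zero_re] at hs; linarith
  have hre : (-s).re < 0 := by rw [Complex.neg_re]; linarith
  set μ := hN.stieltjesFunction.measure.restrict (Ici 1) with hμ
  set ν := (volume : Measure ℝ).restrict (Ioi 0) with hν
  let S : Set (ℝ × ℝ) := {p | p.1 ≤ Real.exp p.2}
  have hS : MeasurableSet S :=
    measurableSet_le measurable_fst (Real.measurable_exp.comp measurable_snd)
  let g : ℝ × ℝ → ℂ := S.indicator fun p => Complex.exp (-s * p.2)
  have hg : AEStronglyMeasurable g (μ.prod ν) :=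
    ((by fun_prop : Measurable fun p : ℝ × ℝ => Complex.exp (-s * p.2)).indicator
      hS).aestronglyMeasurable
  have hsec : ∀ x : ℝ, 1 ≤ x → (fun u => g (x, u)) =ᵐ[ν]
      (Ioi (Real.log x)).indicator fun u : ℝ => Complex.exp (-s * u) := by
    intro x hx
    -- The section of `S` is closed at `log x` while `Ioi` is open; the endpoint is a null set.
    have hne : ∀ᵐ u ∂ν, u ≠ Real.log x :=
      ae_restrict_of_ae (by simpa using (countable_singleton (Real.log x)).ae_notMem volume)
    filter_upwards [hne] with u hu
    by_cases h : Real.log x < u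
    · rw [indicator_of_mem (show u ∈ Ioi (Real.log x) from h)]
      exact indicator_of_mem (show (x, u) ∈ S from
        (Real.log_le_iff_le_exp (by linarith)).mp h.le) _
    · rw [indicator_of_notMem (show u ∉ Ioi (Real.log x) from h)]
      refine indicator_of_notMem (show (x, u) ∉ S from fun h' => h ?_) _
      exact lt_of_le_of_ne ((Real.log_le_iff_le_exp (by linarith)).mpr h') hu.symm
  have hres : ∀ x : ℝ, 1 ≤ x → ν.restrict (Ioi (Real.log x)) = volume.restrict (Ioi (Real.log x)) := by
    intro x hx
    rw [hν, Measure.restrict_restrict measurableSet_Ioi,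
      inter_eq_left.mpr (Ioi_subset_Ioi (Real.log_nonneg hx))]
  have hint : ∀ x : ℝ, 1 ≤ x → Integrable (fun u => g (x, u)) ν := by
    intro x hx
    rw [integrable_congr (hsec x hx), integrable_indicator_iff measurableSet_Ioi, IntegrableOn,
      hres x hx]
    exact integrableOn_exp_mul_complex_Ioi hre _
  have hval : ∀ x : ℝ, 1 ≤ x → ∫ u, g (x, u) ∂ν = (x : ℂ) ^ (-s) / s := by
    intro x hx
    have hx0 : (x : ℂ) ≠ 0 := by exact_mod_cast (by linarith : x ≠ 0)
    rw [integral_congr_ae (hsec x hx), integral_indicator measurableSet_Ioi, hres x hx,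
      integral_exp_mul_complex_Ioi hre, Complex.cpow_def_of_ne_zero hx0,
      ← Complex.ofReal_log (by linarith), mul_comm (-s) _, neg_div_neg_eq]
  have hvaln : ∀ x : ℝ, 1 ≤ x → ∫ u, ‖g (x, u)‖ ∂ν = ‖(x : ℂ) ^ (-s)‖ / s.re := by
    intro x hx
    have hx0 : (x : ℂ) ≠ 0 := by exact_mod_cast (by linarith : x ≠ 0)
    have e : (fun u => ‖g (x, u)‖) =ᵐ[ν]
      (Ioi (Real.log x)).indicator fun u : ℝ => Real.exp (-s.re * u) := by
      filter_upwards [hsec x hx] with u hu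
      rw [hu, norm_indicator_eq_indicator_norm]
      congr 1; funext u
      rw [Complex.norm_exp]; simp
    rw [integral_congr_ae e, integral_indicator measurableSet_Ioi, hres x hx,
      integral_exp_mul_Ioi (by linarith), Complex.norm_cpow_eq_rpow_re_of_pos (by linarith),
      Real.rpow_def_of_pos (by linarith), Complex.neg_re, mul_comm (-s.re) _, neg_div_neg_eq]
  have hprod : Integrable g (μ.prod ν) := by
    rw [integrable_prod_iff hg]
    refine ⟨(ae_restrict_mem measurableSet_Ici).mono fun x hx => hint x hx, ?_⟩
    refine ((hconv s hs).norm.div_const s.re).congr ?_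
    exact (ae_restrict_mem measurableSet_Ici).mono fun x hx => (hvaln x hx).symm
  have hinner : ∀ᵐ u ∂ν, ∫ x, g (x, u) ∂μ =
      (N (Real.exp u) : ℂ) * Complex.exp (-s * u) := by
    filter_upwards [ae_restrict_of_ae hN.ae_stieltjesFunction_exp_eq] with u hu
    have e : (fun x => g (x, u)) = (Iic (Real.exp u)).indicator fun _ => Complex.exp (-s * u) := by
      funext x
      by_cases h : x ≤ Real.exp u
      · rw [indicator_of_mem (show x ∈ Iic (Real.exp u) from h)]
        exact indicator_of_mem (show (x, u) ∈ S from h) _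
      · rw [indicator_of_notMem (show x ∉ Iic (Real.exp u) from h)]
        exact indicator_of_notMem (show (x, u) ∉ S from h) _
    rw [e, integral_indicator measurableSet_Iic, setIntegral_const, Measure.real, hμ,
      Measure.restrict_apply measurableSet_Iic, inter_comm, Ici_inter_Iic,
      hN.stieltjesFunction_measure_Icc_one h0, hu,
      ENNReal.toReal_ofReal (hN.nonneg_of_eq_zero h0 _), Complex.real_smul]
  constructor
  · exact hprod.integral_prod_right.congr hinner
  · rw [← integral_congr_ae hinner, ← integral_prod_symm _ hprod, integral_prod _ hprod,
      setIntegral_congr_fun measurableSet_Ici (fun x hx => hval x hx), integral_div]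
    rfl

end

/-! ### Laplace transforms of truncated half-integral powers. -/

noncomputable section

open MeasureTheory Set Filter Topology

/-- The error term in the identity
`∫_1^∞ u ^ (-j - 1/2) e ^ (-z u) du / Γ(1/2 - j) = z ^ (j - 1/2) + halfPowerLaplaceError j z`. -/
def halfPowerLaplaceError : ℕ → ℂ → ℂ
  | 0, z => -(∫ u in Ioc (0 : ℝ) 1, ((u ^ (-(1 / 2) : ℝ) : ℝ) : ℂ) * Complex.exp (-z * u)) /
      (Real.Gamma (1 / 2) : ℂ)
  | j + 1, z => z * halfPowerLaplaceError j z -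
      Complex.exp (-z) * (((Real.Gamma (-j + 1 / 2))⁻¹ : ℝ) : ℂ)

theorem gamma_half_sub_ne_zero (j : ℕ) : Real.Gamma (-j + 1 / 2) ≠ 0 := by
  refine Real.Gamma_ne_zero fun m h => ?_
  have : (2 * (j : ℤ) : ℝ) - 1 = 2 * (m : ℤ) := by push_cast; linarith
  have h2 : 2 * (j : ℤ) - 1 = 2 * (m : ℤ) := by exact_mod_cast this
  omega

theorem gamma_half_sub_succ (j : ℕ) :
    Real.Gamma (-j + 1 / 2) = (-j - 1 / 2) * Real.Gamma (-(j + 1 : ℕ) + 1 / 2) := by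
  have h : (-((j : ℝ) + 1) + 1 / 2) ≠ 0 := by
    have : (0 : ℝ) ≤ j := Nat.cast_nonneg j
    linarith
  have := Real.Gamma_add_one h
  push_cast
  rw [show -(j : ℝ) + 1 / 2 = (-((j : ℝ) + 1) + 1 / 2) + 1 by ring, this]
  ring

theorem integrableOn_rpow_mul_cexp {p : ℝ} (hp : -1 < p) {z : ℂ} (hz : 0 < z.re) :
    IntegrableOn (fun u : ℝ => ((u ^ p : ℝ) : ℂ) * Complex.exp (-z * u)) (Ioi 0) := by
  have h := integrableOn_rpow_mul_exp_neg_mul_rpow hp one_pos hz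
  refine h.mono' ?_ ((ae_restrict_mem measurableSet_Ioi).mono fun u hu => ?_)
  · exact (by fun_prop : Measurable fun u : ℝ =>
      ((u ^ p : ℝ) : ℂ) * Complex.exp (-z * u)).aestronglyMeasurable
  · rw [norm_mul, Complex.norm_real, Real.norm_eq_abs,
      abs_of_nonneg (Real.rpow_nonneg (le_of_lt hu) _), Complex.norm_exp, Real.rpow_one]
    simp

theorem integrableOn_rpow_mul_cexp_Ioi_one (p : ℝ) {z : ℂ} (hz : 0 < z.re) :
    IntegrableOn (fun u : ℝ => ((u ^ p : ℝ) : ℂ) * Complex.exp (-z * u)) (Ioi 1) := by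
  have h := (integrableOn_rpow_mul_cexp (p := |p|)
    (by linarith [abs_nonneg p]) hz).mono_set (Ioi_subset_Ioi zero_le_one)
  refine h.norm.mono' ?_ ((ae_restrict_mem measurableSet_Ioi).mono fun u hu => ?_)
  · exact (by fun_prop : Measurable fun u : ℝ =>
      ((u ^ p : ℝ) : ℂ) * Complex.exp (-z * u)).aestronglyMeasurable
  · have hu1 : (1 : ℝ) < u := hu
    simp only [norm_mul, Complex.norm_real, Real.norm_eq_abs]
    have hu0 : (0 : ℝ) ≤ u := by linarith
    rw [abs_of_nonneg (Real.rpow_nonneg hu0 _), abs_of_nonneg (Real.rpow_nonneg hu0 _)]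
    gcongr
    · exact hu1.le
    · exact le_abs_self p

/-- The substitution `u = x ^ 2` turns this into a Gaussian integral with complex parameter. The
principal branches agree because `Re z > 0`. -/
theorem integral_rpow_neg_half_mul_cexp {z : ℂ} (hz : 0 < z.re) :
    ∫ u in Ioi (0 : ℝ), ((u ^ (-(1 / 2) : ℝ) : ℝ) : ℂ) * Complex.exp (-z * u) =
      z ^ (-(1 / 2) : ℂ) * (Real.Gamma (1 / 2) : ℂ) := by
  have hz0 : z ≠ 0 := fun h => by simp [h] at hz
  have hpi : (Real.pi : ℂ) ≠ 0 := by exact_mod_cast Real.pi_ne_zero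
  have harg : z.arg ≠ Real.pi := fun h => by
    rw [Complex.arg_eq_pi_iff] at h; linarith [h.1]
  rw [← integral_comp_rpow_Ioi_of_pos (p := 2) two_pos]
  have e : ∀ x ∈ Ioi (0 : ℝ), ((2 : ℝ) * x ^ ((2 : ℝ) - 1)) •
      ((((x ^ (2 : ℝ)) ^ (-(1 / 2) : ℝ) : ℝ) : ℂ) * Complex.exp (-z * ((x ^ (2 : ℝ) : ℝ) : ℂ))) =
      2 * Complex.exp (-z * (x : ℂ) ^ 2) := by
    intro x hx
    have hx0 : (0 : ℝ) < x := hx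
    rw [← Real.rpow_mul hx0.le, show (2 : ℝ) * -(1 / 2) = -1 by norm_num,
      show (2 : ℝ) - 1 = 1 by norm_num, Real.rpow_one, Real.rpow_neg_one, Real.rpow_two,
      Complex.real_smul, ← mul_assoc, ← Complex.ofReal_mul, mul_assoc, mul_inv_cancel₀ hx0.ne']
    push_cast; ring
  rw [setIntegral_congr_fun measurableSet_Ioi e, integral_const_mul,
    integral_gaussian_complex_Ioi hz, Real.Gamma_one_half_eq, div_eq_mul_inv (Real.pi : ℂ) z,
    Complex.cpow_def_of_ne_zero (mul_ne_zero hpi (inv_ne_zero hz0)),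
    Complex.log_ofReal_mul Real.pi_pos (inv_ne_zero hz0), Complex.log_inv _ harg,
    Complex.cpow_def_of_ne_zero hz0, Real.sqrt_eq_rpow, Complex.ofReal_cpow Real.pi_pos.le,
    Complex.cpow_def_of_ne_zero hpi, ← Complex.exp_add, Complex.ofReal_log Real.pi_pos.le]
  push_cast
  ring_nf

/-- Integrate the derivative of `u ^ p * e^{-zu}` over `[1, ∞)`. The boundary term at `1` is the
source of `e^{-z}` in the recursion of `halfPowerLaplaceError`. -/
theorem integral_rpow_succ_mul_cexp (p : ℝ) {z : ℂ} (hz : 0 < z.re) :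
    (p : ℂ) * (∫ u in Ioi (1 : ℝ), ((u ^ (p - 1) : ℝ) : ℂ) * Complex.exp (-z * u)) =
      z * (∫ u in Ioi (1 : ℝ), ((u ^ p : ℝ) : ℂ) * Complex.exp (-z * u)) - Complex.exp (-z) := by
  have i1 := (integrableOn_rpow_mul_cexp_Ioi_one (p - 1) hz).const_mul (p : ℂ)
  have i2 := (integrableOn_rpow_mul_cexp_Ioi_one p hz).const_mul z
  have hd : ∀ u ∈ Ici (1 : ℝ), HasDerivAt
      (fun u : ℝ => ((u ^ p : ℝ) : ℂ) * Complex.exp (-z * u))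
      ((p : ℂ) * (((u ^ (p - 1) : ℝ) : ℂ) * Complex.exp (-z * u)) -
        z * (((u ^ p : ℝ) : ℂ) * Complex.exp (-z * u))) u := by
    intro u hu
    have hu0 : u ≠ 0 := by
      have : (1 : ℝ) ≤ u := hu
      linarith
    have a := (Real.hasDerivAt_rpow_const (p := p) (Or.inl hu0)).ofReal_comp
    have b : HasDerivAt (fun u : ℝ => Complex.exp (-z * u)) (Complex.exp (-z * u) * (-z)) u := by
      have : HasDerivAt (fun u : ℝ => -z * (u : ℂ)) (-z) u := by
        simpa using (Complex.ofRealCLM.hasDerivAt (x := u)).const_mul (-z)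
      exact this.cexp
    exact (a.mul b).congr_deriv (by push_cast; ring)
  have hlim : Tendsto (fun u : ℝ => ((u ^ p : ℝ) : ℂ) * Complex.exp (-z * u)) atTop (𝓝 0) := by
    rw [tendsto_zero_iff_norm_tendsto_zero]
    refine (tendsto_rpow_mul_exp_neg_mul_atTop_nhds_zero p z.re hz).congr' ?_
    filter_upwards [eventually_gt_atTop 0] with u hu
    rw [norm_mul, Complex.norm_real, Real.norm_eq_abs, abs_of_nonneg (by positivity),
      Complex.norm_exp]
    simp
  have := integral_Ioi_of_hasDerivAt_of_tendsto' hd (i1.sub i2) hlim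
  rw [integral_sub i1 i2, integral_const_mul, integral_const_mul] at this
  simp only [Real.one_rpow, Complex.ofReal_one, one_mul, mul_one, zero_sub] at this
  linear_combination this

/-- Induction on `j`. For `j ≥ 1` the power is not integrable at `0`, hence the truncation at `1`;
the factor `-j - 1/2` from integration by parts is the one in the functional equation of `Γ`. -/
theorem integral_halfPower_mul_cexp (j : ℕ) {z : ℂ} (hz : 0 < z.re) :
    ∫ u in Ioi (1 : ℝ), ((u ^ (-(j : ℝ) - 1 / 2) / Real.Gamma (-j + 1 / 2) : ℝ) : ℂ) *
      Complex.exp (-z * u) = z ^ ((j : ℂ) - 1 / 2) + halfPowerLaplaceError j z := by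
  have hz0 : z ≠ 0 := fun h => by simp [h] at hz
  have e : ∀ j : ℕ, ∫ u in Ioi (1 : ℝ), ((u ^ (-(j : ℝ) - 1 / 2) / Real.Gamma (-j + 1 / 2) : ℝ) : ℂ) *
      Complex.exp (-z * u) = (Real.Gamma (-j + 1 / 2) : ℂ)⁻¹ *
        ∫ u in Ioi (1 : ℝ), ((u ^ (-(j : ℝ) - 1 / 2) : ℝ) : ℂ) * Complex.exp (-z * u) := by
    intro j
    rw [← integral_const_mul]
    congr 1; funext u
    push_cast; ring
  rw [e]
  have hG : ∀ j : ℕ, (Real.Gamma (-j + 1 / 2) : ℂ) ≠ 0 := fun j => by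
    exact_mod_cast gamma_half_sub_ne_zero j
  induction j with
  | zero =>
    have h1 := integral_rpow_neg_half_mul_cexp hz
    have h2 := integrableOn_rpow_mul_cexp (p := -(1 / 2)) (by norm_num) hz
    rw [← Ioc_union_Ioi_eq_Ioi zero_le_one, setIntegral_union (Ioc_disjoint_Ioi le_rfl)
      measurableSet_Ioi (h2.mono_set Ioc_subset_Ioi_self)
      (h2.mono_set (Ioi_subset_Ioi zero_le_one))] at h1
    have hG0 := hG 0
    simp only [Nat.cast_zero, neg_zero, zero_add, zero_sub, halfPowerLaplaceError] at hG0 ⊢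
    rw [eq_sub_of_add_eq' h1]
    field_simp
    ring
  | succ j ih =>
    have h1 := integral_rpow_succ_mul_cexp (-(j : ℝ) - 1 / 2) hz
    have h3 : ((-(j : ℝ) - 1 / 2 : ℝ) : ℂ) ≠ 0 := by
      have : (0 : ℝ) ≤ j := Nat.cast_nonneg j
      exact_mod_cast (by linarith : -(j : ℝ) - 1 / 2 ≠ 0)
    have h4 : (Real.Gamma (-(j + 1 : ℕ) + 1 / 2) : ℂ)⁻¹ =
        (Real.Gamma (-j + 1 / 2) : ℂ)⁻¹ * ((-(j : ℝ) - 1 / 2 : ℝ) : ℂ) := by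
      rw [gamma_half_sub_succ j, Complex.ofReal_mul, mul_inv, mul_comm, ← mul_assoc,
        mul_inv_cancel₀ h3, one_mul]
    have h5 : z ^ (((j + 1 : ℕ) : ℂ) - 1 / 2) = z * z ^ ((j : ℂ) - 1 / 2) := by
      rw [show ((j + 1 : ℕ) : ℂ) - 1 / 2 = ((j : ℂ) - 1 / 2) + 1 by push_cast; ring,
        Complex.cpow_add _ _ hz0, Complex.cpow_one, mul_comm]
    have h6 : (-((j + 1 : ℕ) : ℝ) - 1 / 2) = (-(j : ℝ) - 1 / 2) - 1 := by push_cast; ring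
    rw [h4, h5, h6, mul_assoc, h1, halfPowerLaplaceError]
    push_cast at ih ⊢
    linear_combination z * ih

theorem integrableOn_rpow_neg_half : IntegrableOn (fun u : ℝ => u ^ (-(1 / 2) : ℝ)) (Ioc 0 1) := by
  have := intervalIntegral.intervalIntegrable_rpow' (a := 0) (b := 1) (r := -(1 / 2)) (by norm_num)
  exact (intervalIntegrable_iff_integrableOn_Ioc_of_le zero_le_one).mp this

theorem continuous_halfPowerLaplaceError (j : ℕ) : Continuous (halfPowerLaplaceError j) := by
  induction j with
  | zero =>
    refine Continuous.div_const (Continuous.neg ?_) _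
    refine continuous_iff_continuousAt.mpr fun z₀ => ?_
    refine continuousAt_of_dominated
      (bound := fun u : ℝ => u ^ (-(1 / 2) : ℝ) * Real.exp (‖z₀‖ + 1)) ?_ ?_
      (integrableOn_rpow_neg_half.mul_const _) ?_
    · exact Eventually.of_forall fun z => (by fun_prop : Measurable fun u : ℝ =>
        ((u ^ (-(1 / 2) : ℝ) : ℝ) : ℂ) * Complex.exp (-z * u)).aestronglyMeasurable
    · filter_upwards [Metric.ball_mem_nhds z₀ one_pos] with z hz
      filter_upwards [ae_restrict_mem measurableSet_Ioc] with u hu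
      rw [norm_mul, Complex.norm_real, Real.norm_eq_abs,
        abs_of_nonneg (Real.rpow_nonneg hu.1.le _)]
      gcongr
      · exact Real.rpow_nonneg hu.1.le _
      · refine (Complex.norm_exp_le_exp_norm _).trans (Real.exp_le_exp.mpr ?_)
        rw [norm_mul, norm_neg, Complex.norm_real, Real.norm_eq_abs, abs_of_pos hu.1]
        have h1 : ‖z‖ ≤ ‖z₀‖ + 1 := by
          have := norm_le_norm_add_norm_sub' z z₀
          rw [mem_ball_iff_norm] at hz
          linarith
        nlinarith [norm_nonneg z, hu.2]
    · exact Eventually.of_forall fun u => by fun_prop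
  | succ j ih => exact (continuous_id.mul ih).sub ((by fun_prop : Continuous fun z : ℂ =>
      Complex.exp (-z)).mul continuous_const)

end

/-! ### The truncation errors do not affect the oscillatory integrals. -/

noncomputable section

open MeasureTheory Set Filter Topology

/-- The oscillatory integrals of `E` along the imaginary axis, against dilations of the cutoff `χ`,
are `O(l ^ β / x ^ n)`, even after translation of `E` and multiplication with powers. -/
def IsNegligible (χ : ℝ → ℂ) (β : ℝ) (n : ℕ) (E : ℂ → ℂ) : Prop :=
  ∀ (k : ℕ) (τ : ℝ), ∃ C : ℝ, 0 ≤ C ∧ ∀ l : ℝ, 1 ≤ l → ∀ x : ℝ, 2 ≤ x →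
    ‖∫ t : ℝ, χ (l⁻¹ * t) * ((Complex.I * ((t : ℂ) - τ)) ^ k * E (Complex.I * ((t : ℂ) - τ))) *
      Complex.exp (Complex.I * t * x)‖ ≤ C * l ^ β / x ^ n

variable {χ : ℝ → ℂ} {β : ℝ} {n : ℕ} {E E' : ℂ → ℂ}

theorem IsNegligible.const_mul (hE : IsNegligible χ β n E) (c : ℂ) :
    IsNegligible χ β n fun z => c * E z := by
  intro k τ
  obtain ⟨C, hC0, hC⟩ := hE k τ
  refine ⟨‖c‖ * C, by positivity, fun l hl x hx => ?_⟩
  calc _ = ‖c * ∫ t : ℝ, χ (l⁻¹ * t) * ((Complex.I * ((t : ℂ) - τ)) ^ k *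
        E (Complex.I * ((t : ℂ) - τ))) * Complex.exp (Complex.I * t * x)‖ := by
        rw [← integral_const_mul]; congr 2; funext t; ring
    _ ≤ ‖c‖ * (C * l ^ β / x ^ n) := by rw [norm_mul]; gcongr; exact hC l hl x hx
    _ = _ := by ring

/-- Multiplication by `z` only raises the power `k`, which is why the definition quantifies over
`k`. -/
theorem IsNegligible.id_mul (hE : IsNegligible χ β n E) :
    IsNegligible χ β n fun z => z * E z := by
  intro k τ
  obtain ⟨C, hC0, hC⟩ := hE (k + 1) τ
  refine ⟨C, hC0, fun l hl x hx => le_of_eq_of_le ?_ (hC l hl x hx)⟩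
  congr 2; funext t; ring

theorem integrable_cutoff_mul (hχ : ContDiff ℝ (⊤ : ℕ∞) χ) (hc : HasCompactSupport χ)
    {l : ℝ} (hl : 1 ≤ l) {g : ℝ → ℂ} (hg : Continuous g) :
    Integrable fun t : ℝ => χ (l⁻¹ * t) * g t := by
  have hl0 : l ≠ 0 := by linarith
  have hcl : HasCompactSupport (fun t : ℝ => χ (l⁻¹ * t)) :=
    hc.comp_homeomorph (Homeomorph.mulLeft₀ l⁻¹ (inv_ne_zero hl0))
  exact ((hχ.continuous.comp (by fun_prop)).mul hg).integrable_of_hasCompactSupport hcl.mul_right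

theorem integrable_cutoff_mul_mul (hχ : ContDiff ℝ (⊤ : ℕ∞) χ) (hc : HasCompactSupport χ)
    {l : ℝ} (hl : 1 ≤ l) {g h : ℝ → ℂ} (hg : Continuous g) (hh : Continuous h) :
    Integrable fun t : ℝ => χ (l⁻¹ * t) * g t * h t := by
  simpa only [mul_assoc] using integrable_cutoff_mul (g := fun t => g t * h t) hχ hc hl (hg.mul hh)

theorem IsNegligible.sub (hχ : ContDiff ℝ (⊤ : ℕ∞) χ) (hc : HasCompactSupport χ)
    (hE : IsNegligible χ β n E) (hE' : IsNegligible χ β n E') (h1 : Continuous E)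
    (h2 : Continuous E') : IsNegligible χ β n fun z => E z - E' z := by
  intro k τ
  obtain ⟨C, hC0, hC⟩ := hE k τ
  obtain ⟨C', hC0', hC'⟩ := hE' k τ
  refine ⟨C + C', by positivity, fun l hl x hx => ?_⟩
  have i : ∀ {E : ℂ → ℂ}, Continuous E → Integrable fun t : ℝ => χ (l⁻¹ * t) *
      ((Complex.I * ((t : ℂ) - τ)) ^ k * E (Complex.I * ((t : ℂ) - τ))) *
      Complex.exp (Complex.I * t * x) := fun hE =>
    integrable_cutoff_mul_mul hχ hc hl (by fun_prop) (by fun_prop)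
  calc _ = ‖(∫ t : ℝ, χ (l⁻¹ * t) * ((Complex.I * ((t : ℂ) - τ)) ^ k *
        E (Complex.I * ((t : ℂ) - τ))) * Complex.exp (Complex.I * t * x)) -
        ∫ t : ℝ, χ (l⁻¹ * t) * ((Complex.I * ((t : ℂ) - τ)) ^ k *
        E' (Complex.I * ((t : ℂ) - τ))) * Complex.exp (Complex.I * t * x)‖ := by
        rw [← integral_sub (i h1) (i h2)]; congr 2; funext t; ring
    _ ≤ C * l ^ β / x ^ n + C' * l ^ β / x ^ n :=
        (norm_sub_le _ _).trans (add_le_add (hC l hl x hx) (hC' l hl x hx))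
    _ = _ := by ring

/-- The factor `e^{-zu}` shifts the frequency from `x` to `x - u`, which is at least `x / 2` when `u
≤ 1` and `x ≥ 2`. The bound is uniform in `u`, so it can be integrated over `u`. -/
theorem exists_norm_integral_cutoff_pow_mul_exp_le (hχ : ContDiff ℝ (⊤ : ℕ∞) χ)
    (hc : HasCompactSupport χ) (hβ : 0 < β) (n k : ℕ) (τ : ℝ) :
    ∃ C : ℝ, 0 ≤ C ∧ ∀ u ∈ Icc (0 : ℝ) 1, ∀ l : ℝ, 1 ≤ l → ∀ x : ℝ, 2 ≤ x →
      ‖∫ t : ℝ, χ (l⁻¹ * t) * ((Complex.I * ((t : ℂ) - τ)) ^ k *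
        Complex.exp (-(Complex.I * ((t : ℂ) - τ)) * u)) * Complex.exp (Complex.I * t * x)‖
        ≤ C * l ^ β / x ^ n := by
  -- A polynomial of degree `k` is a symbol of order `k`. With `n + k + 1` integrations by parts the
  -- admissible order is `β + n + k`, which is at least `k` even for `n = 0`.
  have hg : IsSymbol (n + k + 1) (β + (n + k + 1 : ℕ) - 1)
      (fun t : ℝ => (Complex.I * ((t : ℂ) - τ)) ^ k) := by
    refine ((isSymbol_affine _ τ).pow k).mono ?_
    push_cast
    have : (0 : ℝ) ≤ n := Nat.cast_nonneg n
    linarith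
  obtain ⟨C, hC0, hC⟩ := hg.exists_norm_integral_cutoff_le hχ hc hβ
  refine ⟨C * 2 ^ (n + k + 1), by positivity, fun u hu l hl x hx => ?_⟩
  have h1 := hC l hl (x - u)
  have e : ∀ t : ℝ, χ (l⁻¹ * t) * ((Complex.I * ((t : ℂ) - τ)) ^ k *
        Complex.exp (-(Complex.I * ((t : ℂ) - τ)) * u)) * Complex.exp (Complex.I * t * x) =
      Complex.exp ((τ * u : ℝ) * Complex.I) * (χ (l⁻¹ * t) * (Complex.I * ((t : ℂ) - τ)) ^ k *
        Complex.exp (Complex.I * t * (x - u : ℝ))) := by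
    intro t
    have : Complex.exp (-(Complex.I * ((t : ℂ) - τ)) * u) * Complex.exp (Complex.I * t * x) =
        Complex.exp ((τ * u : ℝ) * Complex.I) * Complex.exp (Complex.I * t * (x - u : ℝ)) := by
      rw [← Complex.exp_add, ← Complex.exp_add]
      congr 1; push_cast; ring
    linear_combination χ (l⁻¹ * t) * (Complex.I * ((t : ℂ) - τ)) ^ k * this
  simp_rw [e]
  rw [integral_const_mul, norm_mul, Complex.norm_exp_ofReal_mul_I, one_mul]
  have hxu : x / 2 ≤ |x - u| := by
    rw [abs_of_nonneg (by linarith [hu.2])]; linarith [hu.2]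
  have hx2 : 0 < x / 2 := by linarith
  have h3 : (x / 2) ^ (n + k + 1) ≤ |x - u| ^ (n + k + 1) := by gcongr
  have h4 := (mul_le_mul_of_nonneg_left h3 (norm_nonneg _)).trans h1
  rw [← le_div_iff₀ (by positivity)] at h4
  refine h4.trans ?_
  have h5 : x ^ n ≤ x ^ (n + k + 1) := pow_le_pow_right₀ (by linarith) (by omega)
  have h6 : 0 ≤ l ^ β := Real.rpow_nonneg (by linarith) _
  rw [div_pow, div_div_eq_mul_div]
  calc C * l ^ β * 2 ^ (n + k + 1) / x ^ (n + k + 1) ≤ C * l ^ β * 2 ^ (n + k + 1) / x ^ n := by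
        gcongr
    _ = _ := by ring

theorem isNegligible_exp_neg (hχ : ContDiff ℝ (⊤ : ℕ∞) χ) (hc : HasCompactSupport χ) (hβ : 0 < β) :
    IsNegligible χ β n fun z => Complex.exp (-z) := by
  intro k τ
  obtain ⟨C, hC0, hC⟩ := exists_norm_integral_cutoff_pow_mul_exp_le hχ hc hβ n k τ
  refine ⟨C, hC0, fun l hl x hx => ?_⟩
  simpa using hC 1 (by simp) l hl x hx

theorem isNegligible_integral_rpow_mul_cexp (hχ : ContDiff ℝ (⊤ : ℕ∞) χ) (hc : HasCompactSupport χ)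
    (hβ : 0 < β) : IsNegligible χ β n fun z =>
      ∫ u in Ioc (0 : ℝ) 1, ((u ^ (-(1 / 2) : ℝ) : ℝ) : ℂ) * Complex.exp (-z * u) := by
  intro k τ
  obtain ⟨C, hC0, hC⟩ := exists_norm_integral_cutoff_pow_mul_exp_le hχ hc hβ n k τ
  have hnn : ∀ u ∈ Ioc (0 : ℝ) 1, (0 : ℝ) ≤ u ^ (-(1 / 2) : ℝ) := fun u hu =>
    Real.rpow_nonneg hu.1.le _
  refine ⟨C * ∫ u in Ioc (0 : ℝ) 1, u ^ (-(1 / 2) : ℝ),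
    mul_nonneg hC0 (setIntegral_nonneg measurableSet_Ioc hnn), fun l hl x hx => ?_⟩
  let f : ℝ → ℝ → ℂ := fun t u => ((u ^ (-(1 / 2) : ℝ) : ℝ) : ℂ) *
    (χ (l⁻¹ * t) * ((Complex.I * ((t : ℂ) - τ)) ^ k *
        Complex.exp (-(Complex.I * ((t : ℂ) - τ)) * u)) * Complex.exp (Complex.I * t * x))
  have hf : Integrable (Function.uncurry f) (volume.prod (volume.restrict (Ioc (0 : ℝ) 1))) := by
    have h1 : Integrable (fun t : ℝ => χ (l⁻¹ * t) * (Complex.I * ((t : ℂ) - τ)) ^ k) :=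
      integrable_cutoff_mul hχ hc hl (by fun_prop)
    refine (h1.mul_prod integrableOn_rpow_neg_half.ofReal).mono ?_ ?_
    · have := hχ.continuous.measurable
      exact (by fun_prop : Measurable (Function.uncurry f)).aestronglyMeasurable
    · refine Eventually.of_forall fun p => le_of_eq ?_
      have n1 : ‖Complex.exp (-(Complex.I * ((p.1 : ℂ) - τ)) * p.2)‖ = 1 := by
        rw [show -(Complex.I * ((p.1 : ℂ) - τ)) * p.2 =
          ((-(p.1 - τ) * p.2 : ℝ) : ℂ) * Complex.I by push_cast; ring,
          Complex.norm_exp_ofReal_mul_I]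
      have n2 : ‖Complex.exp (Complex.I * p.1 * x)‖ = 1 := by
        rw [show Complex.I * p.1 * x = ((p.1 * x : ℝ) : ℂ) * Complex.I by push_cast; ring,
          Complex.norm_exp_ofReal_mul_I]
      simp only [Function.uncurry, f, norm_mul, n1, n2, mul_one]
      exact mul_comm _ _
  have e : ∀ t : ℝ, χ (l⁻¹ * t) * ((Complex.I * ((t : ℂ) - τ)) ^ k *
      ∫ u in Ioc (0 : ℝ) 1, ((u ^ (-(1 / 2) : ℝ) : ℝ) : ℂ) *
        Complex.exp (-(Complex.I * ((t : ℂ) - τ)) * u)) * Complex.exp (Complex.I * t * x) =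
      ∫ u in Ioc (0 : ℝ) 1, f t u := by
    intro t
    rw [← integral_const_mul, ← integral_const_mul, ← integral_mul_const]
    congr 1; funext u
    ring
  simp_rw [e]
  rw [integral_integral_swap hf]
  calc ‖∫ u in Ioc (0 : ℝ) 1, ∫ t, f t u‖
      ≤ ∫ u in Ioc (0 : ℝ) 1, u ^ (-(1 / 2) : ℝ) * (C * l ^ β / x ^ n) := by
        refine norm_integral_le_of_norm_le (integrableOn_rpow_neg_half.mul_const _) ?_
        refine (ae_restrict_mem measurableSet_Ioc).mono fun u hu => ?_
        rw [integral_const_mul, norm_mul, Complex.norm_real, Real.norm_eq_abs,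
          abs_of_nonneg (hnn u hu)]
        exact mul_le_mul_of_nonneg_left (hC u ⟨hu.1.le, hu.2⟩ l hl x hx) (hnn u hu)
    _ = _ := by rw [integral_mul_const]; ring

theorem isNegligible_halfPowerLaplaceError (hχ : ContDiff ℝ (⊤ : ℕ∞) χ) (hc : HasCompactSupport χ)
    (hβ : 0 < β) (j : ℕ) : IsNegligible χ β n (halfPowerLaplaceError j) := by
  induction j with
  | zero =>
    have := (isNegligible_integral_rpow_mul_cexp (n := n) hχ hc hβ).const_mul
      (-(Real.Gamma (1 / 2) : ℂ)⁻¹)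
    convert this using 2 with z
    rw [halfPowerLaplaceError]; ring
  | succ j ih =>
    have h1 : IsNegligible χ β n fun z =>
        (((Real.Gamma (-j + 1 / 2))⁻¹ : ℝ) : ℂ) * Complex.exp (-z) :=
      (isNegligible_exp_neg hχ hc hβ).const_mul _
    have := IsNegligible.sub hχ hc ih.id_mul h1
      (continuous_id.mul (continuous_halfPowerLaplaceError j)) (by fun_prop)
    convert this using 2 with z
    rw [halfPowerLaplaceError]; ring

end

/-! ### Kernel averages expressed through the Laplace transform. -/

noncomputable section

open MeasureTheory Set Filter Topology

variable {χ : ℝ → ℂ} {K : ℝ → ℝ}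

theorem dilated_kernel_eq (hK : ∀ v : ℝ, (K v : ℂ) = ∫ t : ℝ, χ t * Complex.exp (Complex.I * t * v))
    {l : ℝ} (hl : 1 ≤ l) (v : ℝ) :
    ((l * K (l * v) : ℝ) : ℂ) = ∫ t : ℝ, χ (l⁻¹ * t) * Complex.exp (Complex.I * t * v) := by
  have hl0 : l ≠ 0 := by linarith
  have h := Measure.integral_comp_mul_left
    (fun t : ℝ => χ t * Complex.exp (Complex.I * t * (l * v : ℝ))) l⁻¹
  rw [inv_inv, abs_of_pos (by linarith), ← hK, Complex.real_smul] at h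
  rw [Complex.ofReal_mul, ← h]
  congr 1; funext t
  congr 2
  have : (l : ℂ) ≠ 0 := by exact_mod_cast hl0
  push_cast
  field_simp

theorem integrable_cutoff (hχ : ContDiff ℝ (⊤ : ℕ∞) χ) (hc : HasCompactSupport χ)
    {l : ℝ} (hl : 1 ≤ l) : Integrable fun t : ℝ => χ (l⁻¹ * t) := by
  simpa using integrable_cutoff_mul (g := fun _ => 1) hχ hc hl continuous_const

theorem norm_cexp_I_mul_mul (t v : ℝ) : ‖Complex.exp (Complex.I * t * v)‖ = 1 := by
  rw [show Complex.I * t * v = ((t * v : ℝ) : ℂ) * Complex.I by push_cast; ring,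
    Complex.norm_exp_ofReal_mul_I]

/-- Convolution with a band-limited kernel, in terms of the Laplace transform. -/
theorem integral_mul_dilated_kernel_eq (hχ : ContDiff ℝ (⊤ : ℕ∞) χ) (hc : HasCompactSupport χ)
    (hK : ∀ v : ℝ, (K v : ℂ) = ∫ t : ℝ, χ t * Complex.exp (Complex.I * t * v))
    {f : ℝ → ℂ} {H : ℂ → ℂ}
    (hf : ∀ z : ℂ, 0 < z.re → IntegrableOn (fun u : ℝ => f u * Complex.exp (-z * u)) (Ioi 0))
    (hH : ∀ z : ℂ, 0 < z.re → ∫ u in Ioi (0 : ℝ), f u * Complex.exp (-z * u) = H z)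
    {l : ℝ} (hl : 1 ≤ l) (x : ℝ) {σ : ℝ} (hσ : 0 < σ) :
    ∫ u in Ioi (0 : ℝ), f u * Complex.exp (-σ * u) * ((l * K (l * (x - u)) : ℝ) : ℂ) =
      ∫ t : ℝ, χ (l⁻¹ * t) * H (σ + Complex.I * t) * Complex.exp (Complex.I * t * x) := by
  have hfσ := hf σ (by simpa using hσ)
  let F : ℝ → ℝ → ℂ := fun u t => f u * Complex.exp (-σ * u) *
    (χ (l⁻¹ * t) * Complex.exp (Complex.I * t * (x - u : ℝ)))
  have hF : Integrable (Function.uncurry F) ((volume.restrict (Ioi (0 : ℝ))).prod volume) := by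
    have h1 := hfσ.mul_prod (integrable_cutoff hχ hc hl)
    have h2 : Integrable (fun p : ℝ × ℝ => (f p.1 * Complex.exp (-σ * p.1) * χ (l⁻¹ * p.2)) *
        Complex.exp (Complex.I * p.2 * (x - p.1 : ℝ)))
        ((volume.restrict (Ioi (0 : ℝ))).prod volume) := by
      refine h1.mul_bdd (c := 1) (by fun_prop) (Eventually.of_forall fun p => ?_)
      rw [norm_cexp_I_mul_mul]
    refine h2.congr (Eventually.of_forall fun p => ?_)
    simp only [Function.uncurry, F]; ring
  calc _ = ∫ u in Ioi (0 : ℝ), ∫ t : ℝ, F u t := by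
        congr 1; funext u
        rw [dilated_kernel_eq hK hl, ← integral_const_mul]
    _ = ∫ t : ℝ, ∫ u in Ioi (0 : ℝ), F u t := integral_integral_swap hF
    _ = _ := by
        congr 1; funext t
        rw [← hH (σ + Complex.I * t) (by simpa using hσ), mul_assoc, ← integral_mul_const,
          ← integral_const_mul]
        congr 1; funext u
        simp only [F]
        have : Complex.exp (-σ * u) * Complex.exp (Complex.I * t * (x - u : ℝ)) =
            Complex.exp (-(σ + Complex.I * t) * u) * Complex.exp (Complex.I * t * x) := by
          rw [← Complex.exp_add, ← Complex.exp_add]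
          congr 1; push_cast; ring
        linear_combination f u * χ (l⁻¹ * t) * this

/-- Compactness of `[0, 1]` times the support of the cutoff. The constant depends on `l`, so it
serves only for limits at fixed `l` and for the a priori bound at `l = 1`. -/
theorem exists_bound_laplace_on_cutoff (hc : HasCompactSupport χ) {H : ℂ → ℂ}
    (hH : ContinuousOn H {z | 0 ≤ z.re}) {l : ℝ} (hl : 1 ≤ l) :
    ∃ M : ℝ, 0 ≤ M ∧ ∀ σ ∈ Icc (0 : ℝ) 1, ∀ t : ℝ,
      ‖χ (l⁻¹ * t) * H (σ + Complex.I * t)‖ ≤ M * ‖χ (l⁻¹ * t)‖ := by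
  have hl0 : l ≠ 0 := by linarith
  have hcl : HasCompactSupport (fun t : ℝ => χ (l⁻¹ * t)) :=
    hc.comp_homeomorph (Homeomorph.mulLeft₀ l⁻¹ (inv_ne_zero hl0))
  have hcpt := (isCompact_Icc (a := (0 : ℝ)) (b := 1)).prod hcl.isCompact
  have hcont : ContinuousOn (fun p : ℝ × ℝ => H (p.1 + Complex.I * p.2))
      (Icc (0 : ℝ) 1 ×ˢ tsupport fun t : ℝ => χ (l⁻¹ * t)) := by
    refine hH.comp (by fun_prop) fun p hp => ?_
    simpa using hp.1.1
  obtain ⟨M, hM⟩ := hcpt.exists_bound_of_continuousOn hcont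
  refine ⟨|M|, abs_nonneg M, fun σ hσ t => ?_⟩
  by_cases ht : χ (l⁻¹ * t) = 0
  · simp [ht]
  · rw [norm_mul, mul_comm]
    gcongr
    exact (hM (σ, t) ⟨hσ, subset_tsupport _ ht⟩).trans (le_abs_self M)

theorem continuous_add_I_mul (t : ℝ) : Continuous fun σ : ℝ => (σ : ℂ) + Complex.I * t := by
  fun_prop

theorem ContinuousOn.comp_vertical {H : ℂ → ℂ} (hH : ContinuousOn H {z | 0 ≤ z.re}) {σ : ℝ}
    (hσ : 0 ≤ σ) : Continuous fun t : ℝ => H (σ + Complex.I * t) := by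
  rw [← continuousOn_univ]
  exact hH.comp (by fun_prop) fun t _ => by simpa using hσ

/-- Let `σ → 0+` in `integral_mul_dilated_kernel_eq`. The left side is dominated by `B` times the
kernel, which is where boundedness of `f` enters; the right side is dominated by a multiple of the
cutoff. -/
theorem integral_mul_dilated_kernel_eq_boundary (hχ : ContDiff ℝ (⊤ : ℕ∞) χ)
    (hc : HasCompactSupport χ) (hKc : Continuous K) (hKi : Integrable K)
    (hK : ∀ v : ℝ, (K v : ℂ) = ∫ t : ℝ, χ t * Complex.exp (Complex.I * t * v))
    {f : ℝ → ℝ} {H : ℂ → ℂ} (hH : ContinuousOn H {z | 0 ≤ z.re})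
    (hf : ∀ z : ℂ, 0 < z.re → IntegrableOn (fun u : ℝ => (f u : ℂ) * Complex.exp (-z * u)) (Ioi 0))
    (hfH : ∀ z : ℂ, 0 < z.re → ∫ u in Ioi (0 : ℝ), (f u : ℂ) * Complex.exp (-z * u) = H z)
    (hfm : Measurable f) {B : ℝ} (hB : ∀ u > 0, |f u| ≤ B) {l : ℝ} (hl : 1 ≤ l) (x : ℝ) :
    ((∫ u in Ioi (0 : ℝ), f u * (l * K (l * (x - u))) : ℝ) : ℂ) =
      ∫ t : ℝ, χ (l⁻¹ * t) * H (Complex.I * t) * Complex.exp (Complex.I * t * x) := by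
  have hl0 : l ≠ 0 := by linarith
  obtain ⟨M, hM0, hM⟩ := exists_bound_laplace_on_cutoff hc hH hl
  have hKl : Integrable fun u : ℝ => l * K (l * (x - u)) := by
    have h1 := (hKi.comp_mul_left' hl0).comp_sub_left x
    exact h1.const_mul l
  have hnear : ∀ᶠ σ : ℝ in 𝓝[>] 0, σ ∈ Ioc (0 : ℝ) 1 := Ioc_mem_nhdsGT one_pos
  have lim1 : Tendsto (fun σ : ℝ => ∫ u in Ioi (0 : ℝ), (f u : ℂ) * Complex.exp (-σ * u) *
      ((l * K (l * (x - u)) : ℝ) : ℂ)) (𝓝[>] 0)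
      (𝓝 (∫ u in Ioi (0 : ℝ), (f u : ℂ) * ((l * K (l * (x - u)) : ℝ) : ℂ))) := by
    refine tendsto_integral_filter_of_dominated_convergence
      (fun u => B * ‖l * K (l * (x - u))‖) ?_ ?_ (hKl.norm.const_mul B).integrableOn ?_
    · refine Eventually.of_forall fun σ => Measurable.aestronglyMeasurable ?_
      have := hKc.measurable
      fun_prop
    · filter_upwards [hnear] with σ hσ
      filter_upwards [ae_restrict_mem measurableSet_Ioi] with u hu
      have hu0 : (0 : ℝ) < u := hu
      rw [norm_mul, norm_mul, Complex.norm_real, Complex.norm_real]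
      gcongr
      have : ‖Complex.exp (-σ * u)‖ ≤ 1 := by
        rw [Complex.norm_exp]
        simp only [neg_mul, Complex.neg_re, Complex.re_ofReal_mul, Complex.ofReal_re]
        exact Real.exp_le_one_iff.mpr (by nlinarith [hσ.1])
      calc ‖f u‖ * ‖Complex.exp (-σ * u)‖ ≤ ‖f u‖ * 1 := by gcongr
        _ ≤ B := by rw [mul_one]; exact hB u hu
    · refine Eventually.of_forall fun u => ?_
      have : Continuous fun σ : ℝ => (f u : ℂ) * Complex.exp (-σ * u) *
        ((l * K (l * (x - u)) : ℝ) : ℂ) := by fun_prop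
      simpa using (this.tendsto 0).mono_left nhdsWithin_le_nhds
  have lim2 : Tendsto (fun σ : ℝ => ∫ t : ℝ, χ (l⁻¹ * t) * H (σ + Complex.I * t) *
      Complex.exp (Complex.I * t * x)) (𝓝[>] 0)
      (𝓝 (∫ t : ℝ, χ (l⁻¹ * t) * H (Complex.I * t) * Complex.exp (Complex.I * t * x))) := by
    refine tendsto_integral_filter_of_dominated_convergence
      (fun t => M * ‖χ (l⁻¹ * t)‖) ?_ ?_ ((integrable_cutoff hχ hc hl).norm.const_mul M) ?_
    · filter_upwards [hnear] with σ hσ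
      exact (integrable_cutoff_mul_mul hχ hc hl (hH.comp_vertical hσ.1.le)
        (by fun_prop)).aestronglyMeasurable
    · filter_upwards [hnear] with σ hσ
      refine Eventually.of_forall fun t => ?_
      rw [norm_mul, norm_cexp_I_mul_mul, mul_one]
      exact hM σ ⟨hσ.1.le, hσ.2⟩ t
    · refine Eventually.of_forall fun t => Tendsto.mul_const _ (Tendsto.const_mul _ ?_)
      have h0 : Complex.I * t ∈ {z : ℂ | 0 ≤ z.re} := by simp
      refine (hH _ h0).tendsto.comp (tendsto_nhdsWithin_iff.mpr ⟨?_, ?_⟩)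
      · simpa using ((continuous_add_I_mul t).tendsto 0).mono_left nhdsWithin_le_nhds
      · filter_upwards [hnear] with σ hσ
        simpa using hσ.1.le
  rw [tendsto_nhds_unique lim2 (lim1.congr' ?_), ← integral_complex_ofReal]
  · congr 1; funext u; push_cast; rfl
  · filter_upwards [hnear] with σ hσ
    exact integral_mul_dilated_kernel_eq hχ hc hK hf hfH hl x hσ.1

/-! ### A priori boundedness. -/

/-- A slowly decreasing nonnegative function whose Laplace transform is, up to that of a bounded
function, continuous on the closed half-plane is bounded. -/
theorem exists_bound_of_laplace_continuousOn (hχ : ContDiff ℝ (⊤ : ℕ∞) χ)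
    (hc : HasCompactSupport χ) (hKc : Continuous K) (hKi : Integrable K)
    (hK0 : ∀ v, 0 ≤ K v) (hKpos : 0 < K 0)
    (hK : ∀ v : ℝ, (K v : ℂ) = ∫ t : ℝ, χ t * Complex.exp (Complex.I * t * v))
    {T b : ℝ → ℝ} {H : ℂ → ℂ} (hH : ContinuousOn H {z | 0 ≤ z.re})
    (hT : ∀ z : ℂ, 0 < z.re → IntegrableOn (fun u : ℝ => (T u : ℂ) * Complex.exp (-z * u)) (Ioi 0))
    (hb : ∀ z : ℂ, 0 < z.re → IntegrableOn (fun u : ℝ => (b u : ℂ) * Complex.exp (-z * u)) (Ioi 0))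
    (hfH : ∀ z : ℂ, 0 < z.re →
      ∫ u in Ioi (0 : ℝ), ((T u - b u : ℝ) : ℂ) * Complex.exp (-z * u) = H z)
    {B : ℝ} (hB : ∀ u > 0, |b u| ≤ B) (hT0 : ∀ u, 0 ≤ T u)
    (hslow : ∀ x u, x ≤ u → T x * Real.exp (-(u - x)) ≤ T u) :
    ∃ C, ∀ u > 0, T u ≤ C := by
  obtain ⟨M, hM0, hM⟩ := exists_bound_laplace_on_cutoff (l := 1) hc hH le_rfl
  obtain ⟨δ, hδ0, hδ⟩ : ∃ δ > 0, ∀ v, |v| < δ → K 0 / 2 < K v := by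
    have h1 := hKc.continuousAt.eventually (lt_mem_nhds (half_lt_self hKpos))
    obtain ⟨δ, h0, h2⟩ := Metric.eventually_nhds_iff.mp h1
    exact ⟨δ, h0, fun v hv => h2 (by simpa using hv)⟩
  set κ := ∫ v, K v
  have hB0 : 0 ≤ B := (abs_nonneg _).trans (hB 1 one_pos)
  set C₁ := M * ∫ t : ℝ, ‖χ ((1 : ℝ)⁻¹ * t)‖
  -- On `[x, x + d]` the kernel `K (x - u)` exceeds `K 0 / 2` and `T u ≥ T x * e^{-1}`.
  set d := min (δ / 2) 1
  have hd0 : 0 < d := lt_min (by linarith) one_pos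
  have hdδ : d < δ := (min_le_left _ _).trans_lt (by linarith)
  have hd1 : d ≤ 1 := min_le_right _ _
  have hKb : ∀ v, ‖K v‖ ≤ ∫ t, ‖χ t‖ := by
    intro v
    have := norm_integral_le_integral_norm (μ := volume)
      fun t : ℝ => χ t * Complex.exp (Complex.I * t * v)
    rw [← hK, Complex.norm_real] at this
    simpa only [norm_mul, norm_cexp_I_mul_mul, mul_one] using this
  refine ⟨(C₁ + B * κ) / (d * (Real.exp (-1) * Real.exp (-1) * (K 0 / 2))), fun x hx => ?_⟩
  rw [le_div_iff₀ (by positivity)]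
  -- The damping depends on `x`: `σ u ≤ 1` for `u ≤ x + 1`, so `e^{-σu} ≥ e^{-1}` on the window,
  -- while `σ ≤ 1` keeps the bound `M` uniform. Thus `σ > 0` throughout and no limit is needed.
  set σ := (x + 1)⁻¹
  have hσ0 : 0 < σ := by positivity
  have hσ1 : σ ≤ 1 := inv_le_one_of_one_le₀ (by linarith)
  have hσx : σ * (x + 1) = 1 := inv_mul_cancel₀ (by linarith)
  have hre : ∀ {f : ℝ → ℝ}, (∀ z : ℂ, 0 < z.re →
      IntegrableOn (fun u : ℝ => (f u : ℂ) * Complex.exp (-z * u)) (Ioi 0)) →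
      IntegrableOn (fun u : ℝ => f u * Real.exp (-σ * u) * K (x - u)) (Ioi 0) := by
    intro f hf
    have h1 := (hf σ (by simpa using hσ0)).re
    have h2 : IntegrableOn (fun u : ℝ => f u * Real.exp (-σ * u)) (Ioi 0) := by
      refine Integrable.congr h1 (Eventually.of_forall fun u => ?_)
      have : (f u : ℂ) * Complex.exp (-(σ : ℂ) * u) = ((f u * Real.exp (-σ * u) : ℝ) : ℂ) := by
        push_cast; rfl
      simp only [this]
      exact Complex.ofReal_re _
    exact Integrable.mul_bdd h2 (by fun_prop) (Eventually.of_forall fun u => hKb (x - u))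
  have hid := integral_mul_dilated_kernel_eq (l := 1) hχ hc hK
    (f := fun u => ((T u - b u : ℝ) : ℂ)) (fun z hz => by
      have := (hT z hz).sub (hb z hz)
      refine Integrable.congr this (Eventually.of_forall fun u => ?_)
      simp only [Pi.sub_apply]; push_cast; ring) hfH le_rfl x hσ0
  have e1 : ∫ u in Ioi (0 : ℝ), ((T u - b u : ℝ) : ℂ) * Complex.exp (-σ * u) *
      ((1 * K (1 * (x - u)) : ℝ) : ℂ) =
      ((∫ u in Ioi (0 : ℝ), (T u * Real.exp (-σ * u) * K (x - u) -
        b u * Real.exp (-σ * u) * K (x - u)) : ℝ) : ℂ) := by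
    rw [← integral_complex_ofReal]
    congr 1; funext u
    push_cast; rw [one_mul, one_mul]; ring
  have e2 : |∫ u in Ioi (0 : ℝ), (T u * Real.exp (-σ * u) * K (x - u) -
        b u * Real.exp (-σ * u) * K (x - u))| ≤ C₁ := by
    rw [← Real.norm_eq_abs, ← Complex.norm_real, ← e1, hid]
    refine (norm_integral_le_of_norm_le ((integrable_cutoff hχ hc le_rfl).norm.const_mul M)
      (Eventually.of_forall fun t => ?_)).trans (by rw [integral_const_mul])
    rw [norm_mul, norm_cexp_I_mul_mul, mul_one]
    exact hM σ ⟨hσ0.le, hσ1⟩ t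
  have e3 : ∫ u in Ioi (0 : ℝ), b u * Real.exp (-σ * u) * K (x - u) ≤ B * κ := by
    have hKs : Integrable fun u => K (x - u) := hKi.comp_sub_left x
    calc _ ≤ ∫ u in Ioi (0 : ℝ), B * K (x - u) := by
          refine setIntegral_mono_on (hre hb) (hKs.const_mul B).integrableOn measurableSet_Ioi
            fun u hu => ?_
          have hu0 : (0 : ℝ) < u := hu
          have h1 : Real.exp (-σ * u) ≤ 1 := Real.exp_le_one_iff.mpr (by nlinarith)
          have h2 : b u * Real.exp (-σ * u) ≤ B :=
            (le_abs_self _).trans (by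
              rw [abs_mul, abs_of_pos (Real.exp_pos _)]
              calc |b u| * Real.exp (-σ * u) ≤ B * 1 := by gcongr; exact hB u hu0
                _ = B := mul_one B)
          exact mul_le_mul_of_nonneg_right h2 (hK0 _)
      _ ≤ ∫ u, B * K (x - u) := setIntegral_le_integral (hKs.const_mul B)
          (Eventually.of_forall fun u => mul_nonneg hB0 (hK0 _))
      _ = B * κ := by rw [integral_const_mul, integral_sub_left_eq_self K volume x]
  rw [integral_sub (hre hT) (hre hb)] at e2
  have e4 : ∫ u in Ioi (0 : ℝ), T u * Real.exp (-σ * u) * K (x - u) ≤ C₁ + B * κ := by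
    linarith [le_abs_self ((∫ u in Ioi (0 : ℝ), T u * Real.exp (-σ * u) * K (x - u)) -
      ∫ u in Ioi (0 : ℝ), b u * Real.exp (-σ * u) * K (x - u))]
  refine le_trans ?_ e4
  have hsub : Icc x (x + d) ⊆ Ioi 0 := fun u hu => lt_of_lt_of_le hx hu.1
  calc T x * (d * (Real.exp (-1) * Real.exp (-1) * (K 0 / 2)))
      = ∫ u in Icc x (x + d), T x * Real.exp (-1) * Real.exp (-1) * (K 0 / 2) := by
        rw [setIntegral_const, Measure.real, Real.volume_Icc, ENNReal.toReal_ofReal (by linarith),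
          smul_eq_mul]
        ring
    _ ≤ ∫ u in Icc x (x + d), T u * Real.exp (-σ * u) * K (x - u) := by
        refine setIntegral_mono_on (integrableOn_const (by simp)) ((hre hT).mono_set hsub)
          measurableSet_Icc fun u hu => ?_
        have h1 : T x * Real.exp (-1) ≤ T u := by
          refine le_trans ?_ (hslow x u hu.1)
          gcongr
          · exact hT0 x
          · linarith [hu.2]
        have h2 : Real.exp (-1) ≤ Real.exp (-σ * u) := by
          gcongr
          nlinarith [hu.2]
        have h3 : K 0 / 2 ≤ K (x - u) := by
          refine (hδ _ ?_).le
          rw [abs_sub_comm, abs_of_nonneg (by linarith [hu.1])]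
          linarith [hu.2]
        have := hT0 x
        have := hT0 u
        gcongr
    _ ≤ _ := by
        refine setIntegral_mono_set (hre hT) (Eventually.of_forall fun u => ?_)
          (Eventually.of_forall hsub)
        have := hT0 u
        have := hK0 (x - u)
        positivity

end

/-! ### The Tauberian argument. -/

noncomputable section

open MeasureTheory Set Filter Topology

variable {K : ℝ → ℝ} {γ : ℝ}

theorem integral_dilate_reflect (g : ℝ → ℝ) {l : ℝ} (hl : 0 < l) (y : ℝ) :
    ∫ u, l * g (l * (y - u)) = ∫ v, g v := by
  rw [integral_const_mul, integral_sub_left_eq_self (fun u => g (l * u)) volume y,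
    Measure.integral_comp_mul_left, abs_of_pos (inv_pos.mpr hl), smul_eq_mul,
    mul_inv_cancel_left₀ hl.ne']

theorem integrable_dilate_reflect {g : ℝ → ℝ} (hg : Integrable g) {l : ℝ} (hl : 0 < l) (y : ℝ) :
    Integrable fun u => l * g (l * (y - u)) :=
  ((hg.comp_mul_left' hl.ne').comp_sub_left y).const_mul l

/-- One-sided Tauberian estimate at a point, with respect to a weight `w`. -/
theorem tauberian_pointwise (hK0 : ∀ v, 0 ≤ K v) (hKi : Integrable K)
    (hγ : 0 ≤ γ) (hKγ : Integrable fun v => (1 + 2 * |v|) ^ γ * K v)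
    {f w : ℝ → ℝ} {A B D Φ η l x y : ℝ} (hl : 1 ≤ l) (hA : 0 ≤ A)
    (hfm : Measurable f) (hB : ∀ u > 0, |f u| ≤ B) (hw0 : 0 ≤ w x)
    (hD : 0 ≤ D) (hwD : ∀ u > 0, w u * |f u| ≤ D)
    (hwx : ∀ u > 0, w x ≤ w u * (1 + |x - u|) ^ γ) (hxy : |x - y| ≤ A / l)
    (hloc : ∀ u, |y - u| ≤ A / l → 0 < u ∧ f x - η ≤ f u)
    (hΦ : ∫ u in Ioi (0 : ℝ), f u * (l * K (l * (y - u))) ≤ Φ) :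
    w x * (f x - η) * (∫ v in Icc (-A) A, K v) ≤
      w x * Φ + D * ∫ v in (Icc (-A) A)ᶜ, (1 + 2 * |v|) ^ γ * K v := by
  have hl0 : 0 < l := by linarith
  -- A minorant of the weighted integrand in the variable `v = l (y - u)`: inside the window `f u ≥
  -- f x - η`, outside it `f u ≥ -|f u|` with `|f u|` controlled by `D` and the growth of the
  -- weight.
  let g : ℝ → ℝ := fun v => (Icc (-A) A).indicator (fun v => w x * (f x - η) * K v) v -
    (Icc (-A) A)ᶜ.indicator (fun v => D * ((1 + 2 * |v|) ^ γ * K v)) v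
  have hg1 : Integrable ((Icc (-A) A).indicator fun v => w x * (f x - η) * K v) :=
    (hKi.const_mul _).indicator measurableSet_Icc
  have hg2 : Integrable ((Icc (-A) A)ᶜ.indicator fun v => D * ((1 + 2 * |v|) ^ γ * K v)) :=
    (hKγ.const_mul _).indicator measurableSet_Icc.compl
  have hgint : ∫ v, g v = w x * (f x - η) * (∫ v in Icc (-A) A, K v) -
      D * ∫ v in (Icc (-A) A)ᶜ, (1 + 2 * |v|) ^ γ * K v := by
    rw [integral_sub hg1 hg2, integral_indicator measurableSet_Icc,
      integral_indicator measurableSet_Icc.compl, integral_const_mul, integral_const_mul]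
  have hfk : IntegrableOn (fun u => f u * (l * K (l * (y - u)))) (Ioi 0) := by
    refine Integrable.bdd_mul (c := B) (integrable_dilate_reflect hKi hl0 y).integrableOn
      hfm.aestronglyMeasurable ?_
    exact (ae_restrict_mem measurableSet_Ioi).mono fun u hu => hB u hu
  have hpt : ∀ u, l * g (l * (y - u)) ≤
      (Ioi (0 : ℝ)).indicator (fun u => w x * (f u * (l * K (l * (y - u))))) u := by
    intro u
    have hk : 0 ≤ K (l * (y - u)) := hK0 _
    by_cases hu : |y - u| ≤ A / l
    · have hmem : l * (y - u) ∈ Icc (-A) A := by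
        rw [mem_Icc, ← abs_le, abs_mul, abs_of_pos hl0]
        rwa [le_div_iff₀' hl0] at hu
      obtain ⟨hu0, hfu⟩ := hloc u hu
      rw [indicator_of_mem (show u ∈ Ioi (0 : ℝ) from hu0)]
      simp only [g]
      rw [indicator_of_mem hmem, indicator_of_notMem
        (show l * (y - u) ∉ (Icc (-A) A)ᶜ from fun h => h hmem), sub_zero]
      calc l * (w x * (f x - η) * K (l * (y - u)))
          ≤ l * (w x * f u * K (l * (y - u))) := by gcongr
        _ = _ := by ring
    · have hv : A < |l * (y - u)| := by
        rw [abs_mul, abs_of_pos hl0]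
        rw [not_le, div_lt_iff₀' hl0] at hu
        exact hu
      have hmem : l * (y - u) ∉ Icc (-A) A := by
        rw [mem_Icc, ← abs_le]; exact not_le.mpr hv
      simp only [g]
      rw [indicator_of_notMem hmem, indicator_of_mem (show _ ∈ (Icc (-A) A)ᶜ from hmem), zero_sub]
      have hW : 0 ≤ (1 + 2 * |l * (y - u)|) ^ γ := by positivity
      by_cases hu0 : 0 < u
      · rw [indicator_of_mem (show u ∈ Ioi (0 : ℝ) from hu0)]
        -- Outside the window `|l (y - u)| > A ≥ |x - y|`; this yields the factor `2` in the weight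
        -- `(1 + 2 |v|) ^ γ`.
        have h1 : |x - u| ≤ 2 * |l * (y - u)| := by
          have a1 : |x - u| ≤ |x - y| + |y - u| := abs_sub_le x y u
          have a2 : A / l ≤ A := div_le_self hA hl
          have a3 : |y - u| ≤ |l * (y - u)| := by
            rw [abs_mul, abs_of_pos hl0]
            exact le_mul_of_one_le_left (abs_nonneg _) hl
          linarith
        have h2 : w x * |f u| ≤ D * (1 + 2 * |l * (y - u)|) ^ γ := by
          calc w x * |f u| ≤ (w u * (1 + |x - u|) ^ γ) * |f u| := by gcongr; exact hwx u hu0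
            _ = (w u * |f u|) * (1 + |x - u|) ^ γ := by ring
            _ ≤ D * (1 + 2 * |l * (y - u)|) ^ γ := by
              gcongr
              exact hwD u hu0
        have h3 : -(D * (1 + 2 * |l * (y - u)|) ^ γ) ≤ w x * f u := by
          have := mul_le_mul_of_nonneg_left (neg_abs_le (f u)) hw0
          linarith
        calc _ = l * (-(D * (1 + 2 * |l * (y - u)|) ^ γ) * K (l * (y - u))) := by ring
          _ ≤ l * (w x * f u * K (l * (y - u))) := by gcongr
          _ = _ := by ring
      · rw [indicator_of_notMem (show u ∉ Ioi (0 : ℝ) from hu0)]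
        have : 0 ≤ D * ((1 + 2 * |l * (y - u)|) ^ γ * K (l * (y - u))) := by positivity
        nlinarith
  have hgi : Integrable g := hg1.sub hg2
  have hmono := integral_mono (integrable_dilate_reflect hgi hl0 y)
    ((integrable_indicator_iff measurableSet_Ioi).mpr (hfk.const_mul (w x))) hpt
  rw [integral_indicator measurableSet_Ioi, integral_const_mul (w x)] at hmono
  have e := integral_dilate_reflect g hl0 y
  rw [hgint] at e
  have h5 : w x * ∫ u in Ioi (0 : ℝ), f u * (l * K (l * (y - u))) ≤ w x * Φ := by gcongr
  have h6 : ∫ u, l * g (l * (y - u)) ≤ w x * ∫ u in Ioi (0 : ℝ), f u * (l * K (l * (y - u))) :=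
    hmono
  linarith

/-- As `A` grows, the window carries more than half of the mass of `K` and the weighted tail drops
below a quarter of it. The resulting ratio `1/2` allows the tail contribution to be absorbed in
`tauberian_decay`. -/
theorem exists_window_tail_le (hKc : Continuous K) (hK0 : ∀ v, 0 ≤ K v) (hKpos : 0 < K 0)
    (hKi : Integrable K) (hKγ : Integrable fun v => (1 + 2 * |v|) ^ γ * K v) :
    ∃ A : ℝ, 0 ≤ A ∧ 0 < ∫ v in Icc (-A) A, K v ∧
      ∫ v in (Icc (-A) A)ᶜ, (1 + 2 * |v|) ^ γ * K v ≤ (∫ v in Icc (-A) A, K v) / 2 := by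
  have hpos : 0 < ∫ v, K v :=
    integral_pos_of_integrable_nonneg_nonzero hKc hKi hK0 hKpos.ne'
  have hcv : ∀ {g : ℝ → ℝ}, Integrable g →
      Tendsto (fun A : ℝ => ∫ v in Icc (-A) A, g v) atTop (𝓝 (∫ v, g v)) := by
    intro g hg
    refine (intervalIntegral_tendsto_integral hg tendsto_neg_atTop_atBot tendsto_id).congr' ?_
    filter_upwards [eventually_ge_atTop (0 : ℝ)] with A hA
    rw [intervalIntegral.integral_of_le (by simp only [id]; linarith), integral_Icc_eq_integral_Ioc]
    rfl
  have h1 := (hcv hKi).eventually (lt_mem_nhds (half_lt_self hpos))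
  have h2 := (hcv hKγ).eventually (lt_mem_nhds
    (sub_lt_self (∫ v, (1 + 2 * |v|) ^ γ * K v) (by positivity : 0 < (∫ v, K v) / 4)))
  obtain ⟨A, hA0, hA1, hA2⟩ := ((eventually_ge_atTop (0 : ℝ)).and (h1.and h2)).exists
  refine ⟨A, hA0, by linarith, ?_⟩
  have := integral_add_compl (measurableSet_Icc (a := -A) (b := A)) hKγ
  linarith

/-- Self-improvement: the weighted supremum `D` of `|f|` satisfies `D ≤ C₂ + D / 2`, hence `D ≤ 2
C₂`. Capping the weight at `R` makes `D` finite from mere boundedness of `f`, and the bound does not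
depend on `R`. -/
theorem tauberian_decay (hKc : Continuous K) (hK0 : ∀ v, 0 ≤ K v) (hKpos : 0 < K 0)
    (hKi : Integrable K) (hγ : 0 ≤ γ) (hKγ : Integrable fun v => (1 + 2 * |v|) ^ γ * K v)
    {f : ℝ → ℝ} {B L C₁ : ℝ} (hfm : Measurable f) (hB : ∀ u > 0, |f u| ≤ B) (hL : 0 ≤ L)
    (hC₁ : 0 ≤ C₁) (hslow : ∀ x ≥ 1, ∀ u ≥ x, f x - L * (u - x) ≤ f u)
    (hΦ : ∀ x ≥ 4, ∀ y ≥ x / 2,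
      |∫ u in Ioi (0 : ℝ), f u * (x ^ γ * K (x ^ γ * (y - u)))| ≤ C₁ * x ^ (-γ)) :
    ∃ C : ℝ, 0 ≤ C ∧ ∀ x ≥ 1, |f x| ≤ C * x ^ (-γ) := by
  obtain ⟨A, hA0, hκ, hτ⟩ := exists_window_tail_le hKc hK0 hKpos hKi hKγ
  set κ := ∫ v in Icc (-A) A, K v
  set τ := ∫ v in (Icc (-A) A)ᶜ, (1 + 2 * |v|) ^ γ * K v
  have hB0 : 0 ≤ B := (abs_nonneg _).trans (hB 1 one_pos)
  -- The three contributions are the drop `2 A L / x ^ γ` across the window, the kernel average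
  -- divided by the window mass, and the trivial bound for `x < 2 A + 4`.
  set C₂ := 2 ^ γ * (2 * A * L + C₁ / κ) + (1 + (2 * A + 4)) ^ γ * B with hC₂
  have hC₂0 : 0 ≤ C₂ := by positivity
  have key : ∀ R : ℝ, 0 < R → ∀ u > 0, min ((1 + u) ^ γ) R * |f u| ≤ 2 * C₂ := by
    intro R hR
    let w : ℝ → ℝ := fun u => min ((1 + u) ^ γ) R
    have hw0 : ∀ u > 0, 0 ≤ w u := fun u hu => le_min (by positivity) hR.le
    have hbdd : BddAbove ((fun u => w u * |f u|) '' Ioi 0) := by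
      refine ⟨R * B, ?_⟩
      rintro _ ⟨u, hu, rfl⟩
      have := hw0 u hu
      exact mul_le_mul (min_le_right _ _) (hB u hu) (abs_nonneg _) hR.le
    set D := sSup ((fun u => w u * |f u|) '' Ioi 0)
    have hwD : ∀ u > 0, w u * |f u| ≤ D := fun u hu => le_csSup hbdd ⟨u, hu, rfl⟩
    have hD0 : 0 ≤ D := (mul_nonneg (hw0 1 one_pos) (abs_nonneg _)).trans (hwD 1 one_pos)
    have hwx : ∀ x > 0, ∀ u > 0, w x ≤ w u * (1 + |x - u|) ^ γ := by
      intro x hx u hu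
      have hc : 1 ≤ (1 + |x - u|) ^ γ := Real.one_le_rpow (by linarith [abs_nonneg (x - u)]) hγ
      have h1 : (1 + x) ^ γ ≤ (1 + u) ^ γ * (1 + |x - u|) ^ γ := by
        rw [← Real.mul_rpow (by positivity) (by positivity)]
        gcongr
        nlinarith [le_abs_self (x - u), abs_nonneg (x - u)]
      simp only [w]
      rw [min_mul_of_nonneg _ _ (by positivity)]
      exact min_le_min h1 (le_mul_of_one_le_right hR.le hc)
    have hstep : ∀ x > 0, w x * |f x| ≤ C₂ + D / 2 := by
      intro x hx
      rcases lt_or_ge x (2 * A + 4) with hxs | hxl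
      · have h1 : w x * |f x| ≤ (1 + (2 * A + 4)) ^ γ * B := by
          have : w x ≤ (1 + (2 * A + 4)) ^ γ := (min_le_left _ _).trans (by gcongr)
          exact mul_le_mul this (hB x hx) (abs_nonneg _) (by positivity)
        have : 0 ≤ 2 ^ γ * (2 * A * L + C₁ / κ) := by positivity
        linarith
      -- From `x ≥ 2 A + 4` the shifted centre is at least `x / 2` and every point of the window is
      -- at least `4`.
      · have hl : 1 ≤ x ^ γ := Real.one_le_rpow (by linarith) hγ
        have hl0 : 0 < x ^ γ := by linarith
        have hAl : A / x ^ γ ≤ A := div_le_self hA0 hl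
        have hAl0 : 0 ≤ A / x ^ γ := by positivity
        have hwle : w x ≤ 2 ^ γ * x ^ γ := by
          rw [← Real.mul_rpow two_pos.le hx.le]
          exact (min_le_left _ _).trans (by gcongr; linarith)
        have hxinv : x ^ (-γ) = (x ^ γ)⁻¹ := Real.rpow_neg hx.le γ
        have hfin : ∀ F : ℝ, w x * (F - L * (2 * (A / x ^ γ))) * κ ≤
            w x * (C₁ * x ^ (-γ)) + D * τ → w x * F ≤ C₂ + D / 2 := by
          intro F hF
          have h1 : w x * F * κ ≤ w x * (x ^ γ)⁻¹ * (2 * A * L * κ + C₁) + D * (κ / 2) := by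
            have := mul_le_mul_of_nonneg_left hτ hD0
            rw [hxinv] at hF
            have e : w x * (F - L * (2 * (A / x ^ γ))) * κ =
              w x * F * κ - w x * (x ^ γ)⁻¹ * (2 * A * L * κ) := by
              rw [div_eq_mul_inv]; ring
            rw [e] at hF
            linarith
          have h2 : w x * (x ^ γ)⁻¹ ≤ 2 ^ γ := by
            rwa [← div_eq_mul_inv, div_le_iff₀ hl0]
          have h3 : w x * (x ^ γ)⁻¹ * (2 * A * L * κ + C₁) ≤ 2 ^ γ * (2 * A * L * κ + C₁) := by
            gcongr
          have h4 : w x * F * κ ≤ (2 ^ γ * (2 * A * L + C₁ / κ) + D / 2) * κ := by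
            have e : (2 ^ γ * (2 * A * L + C₁ / κ) + D / 2) * κ =
              2 ^ γ * (2 * A * L * κ + C₁) + D * (κ / 2) := by field_simp
            rw [e]; linarith
          have h5 := le_of_mul_le_mul_right h4 hκ
          have : 0 ≤ (1 + (2 * A + 4)) ^ γ * B := by positivity
          linarith
        -- The centre `x + A / x ^ γ` puts the whole window to the right of `x`, where a large
        -- positive value of `f` persists.
        have hup : w x * f x ≤ C₂ + D / 2 := by
          refine hfin _ (tauberian_pointwise (y := x + A / x ^ γ) hK0 hKi hγ hKγ hl hA0 hfm hB
            (hw0 x hx) hD0 hwD (hwx x hx) ?_ ?_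
            ((le_abs_self _).trans (hΦ x (by linarith) _ (by linarith))))
          · rw [abs_le]; constructor <;> linarith
          · intro u hu
            rw [abs_le] at hu
            have hux : x ≤ u := by linarith [hu.2]
            refine ⟨by linarith, ?_⟩
            have h1 := hslow x (by linarith) u hux
            have h2 : L * (u - x) ≤ L * (2 * (A / x ^ γ)) := by
              gcongr; linarith [hu.1]
            linarith
        -- The mirror image: a very negative value at `x` forces `f` to be negative just to the left
        -- of `x`, so the window lies there and `-f` is used.
        have hlow : w x * -f x ≤ C₂ + D / 2 := by
          refine hfin _ (tauberian_pointwise (f := fun u => -f u) (y := x - A / x ^ γ)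
            hK0 hKi hγ hKγ hl hA0 hfm.neg (fun u hu => by rw [abs_neg]; exact hB u hu)
            (hw0 x hx) hD0 (fun u hu => by rw [abs_neg]; exact hwD u hu) (hwx x hx) ?_ ?_ ?_)
          · rw [abs_le]; constructor <;> linarith
          · intro u hu
            rw [abs_le] at hu
            have hux : u ≤ x := by linarith [hu.1]
            refine ⟨by linarith [hu.2], ?_⟩
            have h1 := hslow u (by linarith [hu.2]) x hux
            have h2 : L * (x - u) ≤ L * (2 * (A / x ^ γ)) := by
              gcongr; linarith [hu.2]
            linarith
          · simp only [neg_mul]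
            rw [integral_neg]
            exact (neg_le_abs _).trans (hΦ x (by linarith) _ (by linarith))
        rcases abs_cases (f x) with ⟨h, _⟩ | ⟨h, _⟩ <;> rw [h] <;> assumption
    have hDle : D ≤ C₂ + D / 2 := by
      refine csSup_le ⟨_, 1, mem_Ioi.mpr one_pos, rfl⟩ ?_
      rintro _ ⟨u, hu, rfl⟩
      exact hstep u hu
    intro u hu
    exact (hwD u hu).trans (by linarith)
  refine ⟨2 * C₂, by positivity, fun x hx => ?_⟩
  have hx0 : 0 < x := by linarith
  have h1 := key ((1 + x) ^ γ) (by positivity) x hx0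
  rw [min_self] at h1
  rw [Real.rpow_neg hx0.le, ← div_eq_mul_inv, le_div_iff₀ (by positivity), mul_comm]
  refine le_trans ?_ h1
  gcongr
  linarith

end

/-! ### Boundary values of the remainder as symbols. -/

noncomputable section

open MeasureTheory Set Filter Topology

theorem uniqueDiffOn_closedHalfPlane : UniqueDiffOn ℂ closedHalfPlane := by
  refine uniqueDiffOn_convex_of_isRCLikeNormedField (𝕜 := ℂ) (convex_halfSpace_re_ge 1) ⟨2, ?_⟩
  refine mem_interior.mpr ⟨{s | 1 < s.re}, fun s (hs : 1 < s.re) => (hs.le : 1 ≤ s.re),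
    isOpen_lt continuous_const Complex.continuous_re, ?_⟩
  change (1 : ℝ) < (2 : ℂ).re
  norm_num

theorem one_add_mul_I_mem (t : ℝ) : (1 : ℂ) + t * Complex.I ∈ closedHalfPlane := by
  change (1 : ℝ) ≤ ((1 : ℂ) + t * Complex.I).re
  simp

variable {n : ℕ} {F : ℂ → ℂ} {β : ℝ}

theorem contDiff_boundary (hF : ContDiffOn ℂ n F closedHalfPlane) :
    ContDiff ℝ n fun t : ℝ => F (1 + t * Complex.I) :=
  (hF.restrict_scalars ℝ).comp_contDiff
    (contDiff_const.add (Complex.ofRealCLM.contDiff.mul contDiff_const)) one_add_mul_I_mem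

/-- The vertical line stays in the closed half-plane, so the chain rule applies to derivatives
within it; each step contributes a factor `i`. -/
theorem iteratedDeriv_boundary (hF : ContDiffOn ℂ n F closedHalfPlane) {k : ℕ} (hk : k ≤ n) :
    iteratedDeriv k (fun t : ℝ => F (1 + t * Complex.I)) = fun t : ℝ =>
      Complex.I ^ k * iteratedDerivWithin k F closedHalfPlane (1 + t * Complex.I) := by
  induction k with
  | zero => simp
  | succ k ih =>
    rw [iteratedDeriv_succ, ih (by omega)]
    funext t
    have h1 : HasDerivWithinAt (iteratedDerivWithin k F closedHalfPlane)
        (iteratedDerivWithin (k + 1) F closedHalfPlane (1 + t * Complex.I)) closedHalfPlane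
        (1 + t * Complex.I) := by
      rw [iteratedDerivWithin_succ]
      exact (hF.differentiableOn_iteratedDerivWithin (by exact_mod_cast hk)
        uniqueDiffOn_closedHalfPlane _ (one_add_mul_I_mem t)).hasDerivWithinAt
    have h2 : HasDerivAt (fun t : ℝ => (1 : ℂ) + t * Complex.I) Complex.I t := by
      simpa using ((Complex.ofRealCLM.hasDerivAt (x := t)).mul_const Complex.I).const_add 1
    have h3 := h1.scomp_hasDerivAt t h2 one_add_mul_I_mem
    refine (h3.const_mul (Complex.I ^ k)).deriv.trans ?_
    rw [smul_eq_mul]; ring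

theorem isSymbol_boundary (hβ : 0 < β) (hF : ContDiffOn ℂ n F closedHalfPlane)
    (hgrowth : ∀ j ≤ n,
      (fun t : ℝ => iteratedDerivWithin j F closedHalfPlane (1 + t * Complex.I))
        =O[Filter.cocompact ℝ] fun t : ℝ => |t| ^ (β + n - j)) :
    IsSymbol n (β + n) fun t : ℝ => F (1 + t * Complex.I) := by
  have hb : ∀ k : ℕ, ∃ C : ℝ, 0 ≤ C ∧ (k ≤ n → ∀ t : ℝ,
      ‖iteratedDeriv k (fun t : ℝ => F (1 + t * Complex.I)) t‖ ≤
        C * (1 + |t|) ^ (β + n - k)) := by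
    intro k
    by_cases hk : k ≤ n
    swap
    · exact ⟨0, le_rfl, fun h => absurd h hk⟩
    -- A nonnegative exponent makes the weight at least `1`, so a constant bound suffices on the
    -- compact exceptional set.
    have hp : 0 ≤ β + n - k := by
      have : (k : ℝ) ≤ n := by exact_mod_cast hk
      linarith
    obtain ⟨C, hC⟩ := (hgrowth k hk).bound
    obtain ⟨s, hs, hsC⟩ := mem_cocompact.mp hC
    have hcont := (contDiff_boundary hF).continuous_iteratedDeriv k (by exact_mod_cast hk)
    obtain ⟨M, hM⟩ := hs.exists_bound_of_continuousOn hcont.continuousOn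
    refine ⟨|M| + |C|, by positivity, fun _ t => ?_⟩
    have h1 : 1 ≤ (1 + |t|) ^ (β + n - k) :=
      Real.one_le_rpow (by linarith [abs_nonneg t]) hp
    have h2 : |t| ^ (β + n - k) ≤ (1 + |t|) ^ (β + n - k) := by
      gcongr; linarith
    by_cases ht : t ∈ s
    · calc _ ≤ M := hM t ht
        _ ≤ (|M| + |C|) * 1 := by linarith [le_abs_self M, abs_nonneg C]
        _ ≤ _ := by gcongr
    · have h3 : ‖iteratedDerivWithin k F closedHalfPlane (1 + t * Complex.I)‖ ≤
          C * ‖|t| ^ (β + n - k)‖ := hsC ht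
      rw [iteratedDeriv_boundary hF hk]
      simp only [norm_mul, norm_pow, Complex.norm_I, one_pow, one_mul]
      refine h3.trans ?_
      rw [Real.norm_eq_abs, abs_of_nonneg (by positivity)]
      calc C * |t| ^ (β + n - k) ≤ |C| * (1 + |t|) ^ (β + n - k) := by
            gcongr; exact le_abs_self C
        _ ≤ _ := by gcongr; linarith [abs_nonneg M]
  choose C hC0 hC using hb
  refine ⟨contDiff_boundary hF, ∑ k ∈ Finset.range (n + 1), C k, fun k hk t =>
    (hC k hk t).trans ?_⟩
  gcongr
  exact Finset.single_le_sum (fun k _ => hC0 k) (Finset.mem_range.mpr (by omega))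

/-- The oscillatory integrals of `g` against dilations of the cutoff `χ` are
`O(l ^ β / x ^ n)`. -/
def HasSmallOscillation (χ : ℝ → ℂ) (β : ℝ) (n : ℕ) (g : ℝ → ℂ) : Prop :=
  Continuous g ∧ ∃ C : ℝ, 0 ≤ C ∧ ∀ l : ℝ, 1 ≤ l → ∀ x : ℝ, 2 ≤ x →
    ‖∫ t : ℝ, χ (l⁻¹ * t) * g t * Complex.exp (Complex.I * t * x)‖ ≤ C * l ^ β / x ^ n

variable {χ : ℝ → ℂ} {g h : ℝ → ℂ}

theorem HasSmallOscillation.const_mul (hg : HasSmallOscillation χ β n g) (c : ℂ) :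
    HasSmallOscillation χ β n fun t => c * g t := by
  obtain ⟨hgc, C, hC0, hC⟩ := hg
  refine ⟨continuous_const.mul hgc, ‖c‖ * C, by positivity, fun l hl x hx => ?_⟩
  calc _ = ‖c * ∫ t : ℝ, χ (l⁻¹ * t) * g t * Complex.exp (Complex.I * t * x)‖ := by
        rw [← integral_const_mul]; congr 2; funext t; ring
    _ ≤ ‖c‖ * (C * l ^ β / x ^ n) := by rw [norm_mul]; gcongr; exact hC l hl x hx
    _ = _ := by ring

theorem HasSmallOscillation.add (hχ : ContDiff ℝ (⊤ : ℕ∞) χ) (hc : HasCompactSupport χ)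
    (hg : HasSmallOscillation χ β n g) (hh : HasSmallOscillation χ β n h) :
    HasSmallOscillation χ β n fun t => g t + h t := by
  obtain ⟨hgc, C, hC0, hC⟩ := hg
  obtain ⟨hhc, C', hC0', hC'⟩ := hh
  refine ⟨hgc.add hhc, C + C', by positivity, fun l hl x hx => ?_⟩
  calc _ = ‖(∫ t : ℝ, χ (l⁻¹ * t) * g t * Complex.exp (Complex.I * t * x)) +
        ∫ t : ℝ, χ (l⁻¹ * t) * h t * Complex.exp (Complex.I * t * x)‖ := by
        rw [← integral_add (integrable_cutoff_mul_mul hχ hc hl hgc (by fun_prop))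
          (integrable_cutoff_mul_mul hχ hc hl hhc (by fun_prop))]
        congr 2; funext t; ring
    _ ≤ C * l ^ β / x ^ n + C' * l ^ β / x ^ n :=
        (norm_add_le _ _).trans (add_le_add (hC l hl x hx) (hC' l hl x hx))
    _ = _ := by ring

theorem HasSmallOscillation.sum (hχ : ContDiff ℝ (⊤ : ℕ∞) χ) (hc : HasCompactSupport χ)
    {ι : Type*} (s : Finset ι) {g : ι → ℝ → ℂ} (hg : ∀ i ∈ s, HasSmallOscillation χ β n (g i)) :
    HasSmallOscillation χ β n fun t => ∑ i ∈ s, g i t := by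
  classical
  induction s using Finset.induction_on with
  | empty =>
    refine ⟨by simpa using continuous_const, 0, le_rfl, fun l hl x hx => ?_⟩
    simp
  | insert i s hi ih =>
    simp_rw [Finset.sum_insert hi]
    exact (hg i (Finset.mem_insert_self i s)).add hχ hc
      (ih fun j hj => hg j (Finset.mem_insert_of_mem hj))

theorem IsSymbol.hasSmallOscillation (hχ : ContDiff ℝ (⊤ : ℕ∞) χ) (hc : HasCompactSupport χ)
    (hβ : 0 < β) (hg : IsSymbol n (β + n - 1) g) : HasSmallOscillation χ β n g := by
  obtain ⟨C, hC0, hC⟩ := hg.exists_norm_integral_cutoff_le hχ hc hβ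
  refine ⟨hg.1.continuous, C, hC0, fun l hl x hx => ?_⟩
  have hx0 : 0 < x := by linarith
  have := hC l hl x
  rwa [abs_of_pos hx0, ← le_div_iff₀ (by positivity)] at this

theorem IsNegligible.hasSmallOscillation {E : ℂ → ℂ} (hE : IsNegligible χ β n E)
    (hEc : Continuous E) (τ : ℝ) :
    HasSmallOscillation χ β n fun t => E (Complex.I * ((t : ℂ) - τ)) := by
  obtain ⟨C, hC0, hC⟩ := hE 0 τ
  refine ⟨by fun_prop, C, hC0, fun l hl x hx => ?_⟩
  simpa only [pow_zero, one_mul] using hC l hl x hx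

/-- The Laplace transform of the remainder, extended to `0 ≤ Re z`. -/
def remainderLaplace (F : ℂ → ℂ) (n : ℕ) (r θ : ℕ → ℝ) (z : ℂ) : ℂ :=
  F (1 + z) * (1 + z)⁻¹ + (-1) * ∑ j ∈ Finset.Icc 1 n,
    (r j * Complex.exp (θ j * Complex.I) * halfPowerLaplaceError j (z - Complex.I) +
      r j * Complex.exp (-(θ j) * Complex.I) * halfPowerLaplaceError j (z + Complex.I))

theorem continuousOn_remainderLaplace (hF : ContDiffOn ℂ n F closedHalfPlane) (r θ : ℕ → ℝ) :
    ContinuousOn (remainderLaplace F n r θ) {z | 0 ≤ z.re} := by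
  have hE := continuous_halfPowerLaplaceError
  refine ContinuousOn.add (ContinuousOn.mul ?_ (ContinuousOn.inv₀ (by fun_prop) ?_))
    (Continuous.continuousOn (by fun_prop))
  · refine hF.continuousOn.comp (by fun_prop) fun z hz => ?_
    change (1 : ℝ) ≤ (1 + z).re
    have : 0 ≤ z.re := hz
    rw [Complex.add_re, Complex.one_re]; linarith
  · intro z hz h
    have h0 : 0 ≤ z.re := hz
    have := congrArg Complex.re h
    rw [Complex.add_re, Complex.one_re, Complex.zero_re] at this
    linarith

theorem hasSmallOscillation_remainderLaplace (hχ : ContDiff ℝ (⊤ : ℕ∞) χ)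
    (hc : HasCompactSupport χ) (hβ : 0 < β) (hF : ContDiffOn ℂ n F closedHalfPlane)
    (hgrowth : ∀ j ≤ n,
      (fun t : ℝ => iteratedDerivWithin j F closedHalfPlane (1 + t * Complex.I))
        =O[Filter.cocompact ℝ] fun t : ℝ => |t| ^ (β + n - j)) (r θ : ℕ → ℝ) :
    HasSmallOscillation χ β n fun t => remainderLaplace F n r θ (Complex.I * t) := by
  have h1 : HasSmallOscillation χ β n fun t : ℝ =>
      F (1 + Complex.I * t) * (1 + Complex.I * t)⁻¹ := by
    refine IsSymbol.hasSmallOscillation hχ hc hβ ?_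
    -- The factor `1 / s` lowers the order from `β + n` to `β + n - 1`, exactly what `n`
    -- integrations by parts can absorb.
    have := (isSymbol_boundary hβ hF hgrowth).mul (isSymbol_inv_one_add_mul_I n)
    simpa only [mul_comm Complex.I, sub_eq_add_neg] using this
  have h2 : ∀ (j : ℕ) (τ : ℝ), HasSmallOscillation χ β n fun t : ℝ =>
      halfPowerLaplaceError j (Complex.I * ((t : ℂ) - τ)) := fun j τ =>
    (isNegligible_halfPowerLaplaceError hχ hc hβ j).hasSmallOscillation
      (continuous_halfPowerLaplaceError j) τ
  have e1 : ∀ t : ℝ, Complex.I * ((t : ℂ) - (1 : ℝ)) = Complex.I * t - Complex.I := by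
    intro t; push_cast; ring
  have e2 : ∀ t : ℝ, Complex.I * ((t : ℂ) - (-1 : ℝ)) = Complex.I * t + Complex.I := by
    intro t; push_cast; ring
  refine h1.add hχ hc (HasSmallOscillation.const_mul
    (HasSmallOscillation.sum hχ hc _ fun j _ => ?_) _)
  refine HasSmallOscillation.add hχ hc (HasSmallOscillation.const_mul ?_ _)
    (HasSmallOscillation.const_mul ?_ _)
  · simpa only [e1] using h2 j 1
  · simpa only [e2] using h2 j (-1)

end

/-! ### The model functions and their transforms. -/

noncomputable section

open MeasureTheory Set Filter Topology

/-- The oscillating term `cos (u + φ) / (Γ(1/2 - j) u ^ (j + 1/2))`, cut off at `u = 1`. -/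
def halfPowerWave (j : ℕ) (φ u : ℝ) : ℝ :=
  (Ici (1 : ℝ)).indicator
    (fun u => Real.cos (u + φ) * (u ^ (-(j : ℝ) - 1 / 2) / Real.Gamma (-j + 1 / 2))) u

theorem measurable_halfPowerWave (j : ℕ) (φ : ℝ) : Measurable (halfPowerWave j φ) :=
  Measurable.indicator (by fun_prop) measurableSet_Ici

theorem abs_halfPowerWave_le (j : ℕ) (φ u : ℝ) :
    |halfPowerWave j φ u| ≤ |(Real.Gamma (-j + 1 / 2))⁻¹| := by
  rw [halfPowerWave]
  by_cases hu : u ∈ Ici (1 : ℝ)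
  · have hu1 : (1 : ℝ) ≤ u := hu
    rw [indicator_of_mem hu, div_eq_mul_inv, ← mul_assoc, abs_mul, abs_mul]
    have h1 : |u ^ (-(j : ℝ) - 1 / 2)| ≤ 1 := by
      rw [abs_of_nonneg (by positivity)]
      exact Real.rpow_le_one_of_one_le_of_nonpos hu1 (by
        have : (0 : ℝ) ≤ j := Nat.cast_nonneg j
        linarith)
    calc _ ≤ 1 * 1 * |(Real.Gamma (-j + 1 / 2))⁻¹| := by
          gcongr; exact Real.abs_cos_le_one _
      _ = _ := by ring
  · rw [indicator_of_notMem hu, abs_zero]; positivity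

/-- The derivative is bounded on `[1, ∞)`; the restriction `x ≥ 1` avoids the jump at the cutoff
point. -/
theorem exists_abs_halfPowerWave_sub_le (j : ℕ) (φ : ℝ) :
    ∃ L : ℝ, 0 ≤ L ∧ ∀ x ≥ 1, ∀ u ≥ x, |halfPowerWave j φ u - halfPowerWave j φ x| ≤ L * (u - x) := by
  set p : ℝ := -(j : ℝ) - 1 / 2 with hp
  have hp0 : p ≤ 0 := by
    have : (0 : ℝ) ≤ j := Nat.cast_nonneg j
    rw [hp]; linarith
  set c := (Real.Gamma (-j + 1 / 2))⁻¹
  refine ⟨(1 + |p|) * |c|, by positivity, fun x hx u hu => ?_⟩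
  let f : ℝ → ℝ := fun u => Real.cos (u + φ) * (u ^ p * c)
  have hd : ∀ v ∈ Ici (1 : ℝ), HasDerivWithinAt f
      (-Real.sin (v + φ) * (v ^ p * c) + Real.cos (v + φ) * (p * v ^ (p - 1) * c)) (Ici 1) v := by
    intro v hv
    have hv0 : v ≠ 0 := by
      have : (1 : ℝ) ≤ v := hv
      linarith
    have h1 : HasDerivAt (fun v => Real.cos (v + φ)) (-Real.sin (v + φ)) v := by
      simpa using ((hasDerivAt_id v).add_const φ).cos
    have h2 := (Real.hasDerivAt_rpow_const (p := p) (Or.inl hv0)).mul_const c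
    exact (h1.mul h2).hasDerivWithinAt
  have hb : ∀ v ∈ Ici (1 : ℝ),
      ‖-Real.sin (v + φ) * (v ^ p * c) + Real.cos (v + φ) * (p * v ^ (p - 1) * c)‖ ≤
        (1 + |p|) * |c| := by
    intro v hv
    have hv1 : (1 : ℝ) ≤ v := hv
    have a1 : |v ^ p| ≤ 1 := by
      rw [abs_of_nonneg (by positivity)]
      exact Real.rpow_le_one_of_one_le_of_nonpos hv1 hp0
    have a2 : |v ^ (p - 1)| ≤ 1 := by
      rw [abs_of_nonneg (by positivity)]
      exact Real.rpow_le_one_of_one_le_of_nonpos hv1 (by linarith)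
    refine (norm_add_le _ _).trans ?_
    simp only [Real.norm_eq_abs, abs_mul, abs_neg]
    calc _ ≤ 1 * (1 * |c|) + 1 * (|p| * 1 * |c|) := by
          gcongr
          · exact Real.abs_sin_le_one _
          · exact Real.abs_cos_le_one _
      _ = _ := by ring
  have hx1 : x ∈ Ici (1 : ℝ) := hx
  have hu1 : u ∈ Ici (1 : ℝ) := le_trans hx hu
  have := (convex_Ici (1 : ℝ)).norm_image_sub_le_of_norm_hasDerivWithin_le hd hb hx1 hu1
  rw [halfPowerWave, halfPowerWave, indicator_of_mem hx1, indicator_of_mem hu1]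
  rwa [Real.norm_eq_abs, Real.norm_eq_abs, abs_of_nonneg (by linarith : 0 ≤ u - x)] at this

theorem integrableOn_mul_cexp_of_bounded {b : ℝ → ℝ} (hbm : Measurable b) {B : ℝ}
    (hB : ∀ u > 0, |b u| ≤ B) {z : ℂ} (hz : 0 < z.re) :
    IntegrableOn (fun u : ℝ => (b u : ℂ) * Complex.exp (-z * u)) (Ioi 0) := by
  have h := integrableOn_exp_mul_complex_Ioi (a := -z) (by simpa using hz) 0
  refine Integrable.bdd_mul (c := B) h (by fun_prop) ?_
  refine (ae_restrict_mem measurableSet_Ioi).mono fun u hu => ?_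
  rw [Complex.norm_real]
  exact hB u hu

/-- The two exponentials of the cosine shift `z` by `∓ i`, which places the singularities at `s = 1
± i`. -/
theorem integral_halfPowerWave_mul_cexp (j : ℕ) (φ : ℝ) {z : ℂ} (hz : 0 < z.re) :
    ∫ u in Ioi (0 : ℝ), ((2 * halfPowerWave j φ u : ℝ) : ℂ) * Complex.exp (-z * u) =
      Complex.exp (φ * Complex.I) *
        ((z - Complex.I) ^ ((j : ℂ) - 1 / 2) + halfPowerLaplaceError j (z - Complex.I)) +
      Complex.exp (-φ * Complex.I) *
        ((z + Complex.I) ^ ((j : ℂ) - 1 / 2) + halfPowerLaplaceError j (z + Complex.I)) := by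
  have hz1 : 0 < (z - Complex.I).re := by simpa using hz
  have hz2 : 0 < (z + Complex.I).re := by simpa using hz
  have hint : ∀ {w : ℂ}, 0 < w.re → IntegrableOn (fun u : ℝ =>
      ((u ^ (-(j : ℝ) - 1 / 2) / Real.Gamma (-j + 1 / 2) : ℝ) : ℂ) * Complex.exp (-w * u))
      (Ioi 1) := by
    intro w hw
    refine ((integrableOn_rpow_mul_cexp_Ioi_one (-(j : ℝ) - 1 / 2) hw).const_mul
      (Real.Gamma (-j + 1 / 2) : ℂ)⁻¹).congr (Eventually.of_forall fun u => ?_)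
    push_cast; ring
  rw [← integral_halfPower_mul_cexp j hz1, ← integral_halfPower_mul_cexp j hz2,
    ← integral_const_mul, ← integral_const_mul,
    ← integral_add ((hint hz1).const_mul _) ((hint hz2).const_mul _)]
  have e : ∀ u : ℝ, ((2 * halfPowerWave j φ u : ℝ) : ℂ) * Complex.exp (-z * u) =
      (Ici (1 : ℝ)).indicator (fun u : ℝ => Complex.exp (φ * Complex.I) *
        (((u ^ (-(j : ℝ) - 1 / 2) / Real.Gamma (-j + 1 / 2) : ℝ) : ℂ) *
          Complex.exp (-(z - Complex.I) * u)) + Complex.exp (-φ * Complex.I) *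
        (((u ^ (-(j : ℝ) - 1 / 2) / Real.Gamma (-j + 1 / 2) : ℝ) : ℂ) *
          Complex.exp (-(z + Complex.I) * u))) u := by
    intro u
    rw [halfPowerWave]
    by_cases hu : u ∈ Ici (1 : ℝ)
    · rw [indicator_of_mem hu, indicator_of_mem hu]
      have h1 : Complex.exp (-(z - Complex.I) * u) =
          Complex.exp (-z * u) * Complex.exp (u * Complex.I) := by
        rw [← Complex.exp_add]; congr 1; ring
      have h2 : Complex.exp (-(z + Complex.I) * u) =
          Complex.exp (-z * u) * Complex.exp (-u * Complex.I) := by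
        rw [← Complex.exp_add]; congr 1; ring
      have h3 : 2 * Complex.cos (u + φ) =
          Complex.exp (φ * Complex.I) * Complex.exp (u * Complex.I) +
          Complex.exp (-φ * Complex.I) * Complex.exp (-u * Complex.I) := by
        rw [Complex.two_cos, ← Complex.exp_add, ← Complex.exp_add]
        congr 2 <;> ring
      rw [h1, h2]
      push_cast
      linear_combination ((u ^ (-(j : ℝ) - 1 / 2) : ℝ) : ℂ) / (Real.Gamma (-j + 1 / 2) : ℂ) *
        Complex.exp (-z * u) * h3
    · rw [indicator_of_notMem hu, indicator_of_notMem hu]; simp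
  simp_rw [e]
  rw [setIntegral_indicator measurableSet_Ici,
    inter_eq_right.mpr (Ici_subset_Ioi.mpr one_pos),
    integral_Ici_eq_integral_Ioi]

/-- The correction `-a * exp (-u)` makes the transform exactly the pole term `a / (s - 1)` divided
by `s`; in `N` it costs only the constant `a`. -/
theorem integral_one_sub_exp_mul_cexp (a : ℝ) {z : ℂ} (hz : 0 < z.re) :
    ∫ u in Ioi (0 : ℝ), ((a * (1 - Real.exp (-u)) : ℝ) : ℂ) * Complex.exp (-z * u) =
      a / z * (1 + z)⁻¹ := by
  have hz0 : z ≠ 0 := fun h => by simp [h] at hz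
  have hz1 : 0 < (1 + z).re := by rw [Complex.add_re, Complex.one_re]; linarith
  have hz10 : 1 + z ≠ 0 := fun h => by simp [h] at hz1
  have h1 : (-z).re < 0 := by simpa using hz
  have h2 : (-(1 + z)).re < 0 := by rw [Complex.neg_re]; linarith
  have i1 := integrableOn_exp_mul_complex_Ioi h1 0
  have i2 := integrableOn_exp_mul_complex_Ioi h2 0
  have e : ∀ u : ℝ, ((a * (1 - Real.exp (-u)) : ℝ) : ℂ) * Complex.exp (-z * u) =
      a * (Complex.exp (-z * u) - Complex.exp (-(1 + z) * u)) := by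
    intro u
    have : Complex.exp (-(1 + z) * u) = Complex.exp (-u) * Complex.exp (-z * u) := by
      rw [← Complex.exp_add]; congr 1; ring
    rw [this]; push_cast; ring
  simp_rw [e]
  rw [integral_const_mul, integral_sub i1 i2, integral_exp_mul_complex_Ioi h1,
    integral_exp_mul_complex_Ioi h2]
  simp only [Complex.ofReal_zero, mul_zero, Complex.exp_zero]
  field_simp
  ring

end

/-! ### Assembly of the main term and the remainder. -/

noncomputable section

open MeasureTheory Set Filter Topology

/-- The main term of `N (e ^ u) / e ^ u`. -/
def scaledMainTerm (n : ℕ) (a : ℝ) (r θ : ℕ → ℝ) (u : ℝ) : ℝ :=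
  a * (1 - Real.exp (-u)) + ∑ j ∈ Finset.Icc 1 n, r j * (2 * halfPowerWave j (θ j) u)

theorem measurable_scaledMainTerm (n : ℕ) (a : ℝ) (r θ : ℕ → ℝ) :
    Measurable (scaledMainTerm n a r θ) := by
  have := measurable_halfPowerWave
  unfold scaledMainTerm
  fun_prop

theorem exists_abs_scaledMainTerm_le (n : ℕ) (a : ℝ) (r θ : ℕ → ℝ) :
    ∃ B : ℝ, ∀ u > 0, |scaledMainTerm n a r θ u| ≤ B := by
  refine ⟨|a| + ∑ j ∈ Finset.Icc 1 n, |r j| * (2 * |(Real.Gamma (-j + 1 / 2))⁻¹|),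
    fun u hu => ?_⟩
  refine (abs_add_le _ _).trans (add_le_add ?_ ((Finset.abs_sum_le_sum_abs _ _).trans
    (Finset.sum_le_sum fun j _ => ?_)))
  · rw [abs_mul]
    refine mul_le_of_le_one_right (abs_nonneg a) ?_
    have h1 : Real.exp (-u) ≤ 1 := Real.exp_le_one_iff.mpr (by linarith)
    have h2 := Real.exp_pos (-u)
    rw [abs_le]; constructor <;> linarith
  · rw [abs_mul, abs_mul, abs_two]
    exact mul_le_mul_of_nonneg_left (mul_le_mul_of_nonneg_left (abs_halfPowerWave_le _ _ _)
      two_pos.le) (abs_nonneg _)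

theorem exists_abs_scaledMainTerm_sub_le (n : ℕ) (a : ℝ) (r θ : ℕ → ℝ) :
    ∃ L : ℝ, 0 ≤ L ∧ ∀ x ≥ 1, ∀ u ≥ x,
      |scaledMainTerm n a r θ u - scaledMainTerm n a r θ x| ≤ L * (u - x) := by
  choose L hL0 hL using fun j => exists_abs_halfPowerWave_sub_le j (θ j)
  refine ⟨|a| + ∑ j ∈ Finset.Icc 1 n, |r j| * (2 * L j), ?_, fun x hx u hu => ?_⟩
  · have : ∀ j ∈ Finset.Icc 1 n, 0 ≤ |r j| * (2 * L j) := fun j _ => by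
      have := hL0 j
      positivity
    have := Finset.sum_nonneg this
    positivity
  have e : scaledMainTerm n a r θ u - scaledMainTerm n a r θ x =
      a * (Real.exp (-x) - Real.exp (-u)) + ∑ j ∈ Finset.Icc 1 n,
        r j * (2 * (halfPowerWave j (θ j) u - halfPowerWave j (θ j) x)) := by
    rw [scaledMainTerm, scaledMainTerm, add_sub_add_comm, ← Finset.sum_sub_distrib]
    congr 1
    · ring
    · exact Finset.sum_congr rfl fun j _ => by ring
  rw [e, add_mul, Finset.sum_mul]
  refine (abs_add_le _ _).trans (add_le_add ?_ ((Finset.abs_sum_le_sum_abs _ _).trans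
    (Finset.sum_le_sum fun j _ => ?_)))
  · rw [abs_mul]
    gcongr
    have h1 : Real.exp (-u) ≤ Real.exp (-x) := Real.exp_le_exp.mpr (by linarith)
    rw [abs_of_nonneg (by linarith)]
    have h2 : Real.exp (-u) = Real.exp (-x) * Real.exp (-(u - x)) := by
      rw [← Real.exp_add]; congr 1; ring
    have h3 := Real.add_one_le_exp (-(u - x))
    have h4 : Real.exp (-x) ≤ 1 := Real.exp_le_one_iff.mpr (by linarith)
    have h5 := Real.exp_pos (-x)
    rw [h2]
    nlinarith
  · rw [abs_mul, abs_mul, abs_two, mul_assoc, mul_assoc]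
    gcongr
    exact hL j x hx u hu

theorem integral_scaledMainTerm_mul_cexp (n : ℕ) (a : ℝ) (r θ : ℕ → ℝ) {z : ℂ} (hz : 0 < z.re) :
    ∫ u in Ioi (0 : ℝ), (scaledMainTerm n a r θ u : ℂ) * Complex.exp (-z * u) =
      a / z * (1 + z)⁻¹ + ∑ j ∈ Finset.Icc 1 n, (r j : ℂ) * (Complex.exp (θ j * Complex.I) *
        ((z - Complex.I) ^ ((j : ℂ) - 1 / 2) + halfPowerLaplaceError j (z - Complex.I)) +
      Complex.exp (-(θ j) * Complex.I) *
        ((z + Complex.I) ^ ((j : ℂ) - 1 / 2) + halfPowerLaplaceError j (z + Complex.I))) := by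
  have i1 : IntegrableOn (fun u : ℝ => ((a * (1 - Real.exp (-u)) : ℝ) : ℂ) *
      Complex.exp (-z * u)) (Ioi 0) := by
    refine integrableOn_mul_cexp_of_bounded (by fun_prop) (B := |a|) (fun u hu => ?_) hz
    rw [abs_mul]
    refine mul_le_of_le_one_right (abs_nonneg a) ?_
    have h1 : Real.exp (-u) ≤ 1 := Real.exp_le_one_iff.mpr (by linarith)
    have h2 := Real.exp_pos (-u)
    rw [abs_le]; constructor <;> linarith
  have i2 : ∀ j : ℕ, IntegrableOn (fun u : ℝ => (r j : ℂ) *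
      (((2 * halfPowerWave j (θ j) u : ℝ) : ℂ) * Complex.exp (-z * u))) (Ioi 0) := by
    intro j
    refine Integrable.const_mul (integrableOn_mul_cexp_of_bounded
      ((measurable_halfPowerWave j (θ j)).const_mul 2)
      (B := 2 * |(Real.Gamma (-j + 1 / 2))⁻¹|) (fun u hu => ?_) hz) _
    rw [abs_mul, abs_two]
    exact mul_le_mul_of_nonneg_left (abs_halfPowerWave_le _ _ _) two_pos.le
  rw [← integral_one_sub_exp_mul_cexp a hz]
  simp_rw [← integral_halfPowerWave_mul_cexp _ _ hz, ← integral_const_mul]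
  rw [← integral_finsetSum _ fun j _ => i2 j, ← integral_add i1
    (integrable_finsetSum _ fun j _ => i2 j)]
  congr 1; funext u
  rw [scaledMainTerm, Complex.ofReal_add, add_mul, Complex.ofReal_sum, Finset.sum_mul]
  congr 1
  refine Finset.sum_congr rfl fun j _ => ?_
  push_cast; ring

/-- The factor `s` in front of the sum in `zetaRemainder` cancels `1 + z`, so pole and half powers
disappear and only the extension and the truncation errors survive. -/
theorem stieltjesZeta_one_add_div {N : ℝ → ℝ} (hN : Monotone N) {n : ℕ} {a : ℝ} {r θ : ℕ → ℝ}
    {F : ℂ → ℂ} (hF : IsCnExtension n (zetaRemainder N hN n a r θ) F) {z : ℂ} (hz : 0 < z.re) :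
    stieltjesZeta N hN (1 + z) / (1 + z) - (a / z * (1 + z)⁻¹ + ∑ j ∈ Finset.Icc 1 n,
      (r j : ℂ) * (Complex.exp (θ j * Complex.I) *
        ((z - Complex.I) ^ ((j : ℂ) - 1 / 2) + halfPowerLaplaceError j (z - Complex.I)) +
      Complex.exp (-(θ j) * Complex.I) *
        ((z + Complex.I) ^ ((j : ℂ) - 1 / 2) + halfPowerLaplaceError j (z + Complex.I)))) =
      remainderLaplace F n r θ z := by
  have h1 : 1 < (1 + z).re := by rw [Complex.add_re, Complex.one_re]; linarith
  have hz1 : 1 + z ≠ 0 := fun h => by rw [h, Complex.zero_re] at h1; linarith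
  rw [remainderLaplace, hF.2 _ h1, zetaRemainder, add_sub_cancel_left]
  have e : ∑ j ∈ Finset.Icc 1 n, (r j : ℂ) * (Complex.exp (θ j * Complex.I) *
        ((z - Complex.I) ^ ((j : ℂ) - 1 / 2) + halfPowerLaplaceError j (z - Complex.I)) +
      Complex.exp (-(θ j) * Complex.I) *
        ((z + Complex.I) ^ ((j : ℂ) - 1 / 2) + halfPowerLaplaceError j (z + Complex.I))) =
      (∑ j ∈ Finset.Icc 1 n,
        (r j * Complex.exp (θ j * Complex.I) * (z - Complex.I) ^ ((j : ℂ) - 1 / 2)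
          + r j * Complex.exp (-(θ j) * Complex.I) * (z + Complex.I) ^ ((j : ℂ) - 1 / 2))) +
      ∑ j ∈ Finset.Icc 1 n,
    (r j * Complex.exp (θ j * Complex.I) * halfPowerLaplaceError j (z - Complex.I) +
      r j * Complex.exp (-(θ j) * Complex.I) * halfPowerLaplaceError j (z + Complex.I)) := by
    rw [← Finset.sum_add_distrib]
    exact Finset.sum_congr rfl fun j _ => by ring
  rw [e, sub_mul, sub_mul, mul_right_comm, mul_inv_cancel₀ hz1]
  ring

theorem exists_scaled_remainder_le {N : ℝ → ℝ} (hN : Monotone N) (hN_zero : ∀ x < 1, N x = 0)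
    (hconv : StieltjesZetaConverges N hN) (n : ℕ) (a : ℝ) (r θ : ℕ → ℝ) {β : ℝ} (hβ : 0 < β)
    (F : ℂ → ℂ) (hF : IsCnExtension n (zetaRemainder N hN n a r θ) F)
    (hgrowth : ∀ j ≤ n,
      (fun t : ℝ => iteratedDerivWithin j F closedHalfPlane (1 + t * Complex.I))
        =O[Filter.cocompact ℝ] fun t : ℝ => |t| ^ (β + n - j)) :
    ∃ C : ℝ, 0 ≤ C ∧ ∀ x ≥ 1, |N (Real.exp x) * Real.exp (-x) - scaledMainTerm n a r θ x| ≤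
      C * x ^ (-((n : ℝ) / (1 + β))) := by
  obtain ⟨χ, K, hχ, hc, hKc, hK0, hKpos, hK, hKγ⟩ := exists_bandlimited_kernel
  have hKi : Integrable K := by simpa using hKγ 0
  set T : ℝ → ℝ := fun u => N (Real.exp u) * Real.exp (-u) with hT_def
  set b := scaledMainTerm n a r θ with hb_def
  set γ : ℝ := (n : ℝ) / (1 + β) with hγ_def
  have hγ0 : 0 ≤ γ := by positivity
  have hbm : Measurable b := measurable_scaledMainTerm n a r θ
  have hTm : Measurable T := (hN.measurable.comp Real.measurable_exp).mul (by fun_prop)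
  obtain ⟨B, hB⟩ := exists_abs_scaledMainTerm_le n a r θ
  obtain ⟨L, hL0, hL⟩ := exists_abs_scaledMainTerm_sub_le n a r θ
  have hNnn := hN.nonneg_of_eq_zero hN_zero
  have hT0 : ∀ u, 0 ≤ T u := fun u => mul_nonneg (hNnn _) (Real.exp_pos _).le
  have hTslow : ∀ x u, x ≤ u → T x * Real.exp (-(u - x)) ≤ T u := by
    intro x u hxu
    have e : T x * Real.exp (-(u - x)) = N (Real.exp x) * Real.exp (-u) := by
      simp only [T]
      rw [mul_assoc, ← Real.exp_add]; congr 2; ring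
    rw [e]
    exact mul_le_mul_of_nonneg_right (hN (Real.exp_le_exp.mpr hxu)) (Real.exp_pos _).le
  have hTe : ∀ (z : ℂ) (u : ℝ), (T u : ℂ) * Complex.exp (-z * u) =
      (N (Real.exp u) : ℂ) * Complex.exp (-(1 + z) * u) := by
    intro z u
    have : Complex.exp (-(1 + z) * u) = Complex.exp (-u) * Complex.exp (-z * u) := by
      rw [← Complex.exp_add]; congr 1; ring
    rw [this]; simp only [T]; push_cast; ring
  have hTL : ∀ z : ℂ, 0 < z.re →
      IntegrableOn (fun u : ℝ => (T u : ℂ) * Complex.exp (-z * u)) (Ioi 0) ∧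
      ∫ u in Ioi (0 : ℝ), (T u : ℂ) * Complex.exp (-z * u) =
        stieltjesZeta N hN (1 + z) / (1 + z) := by
    intro z hz
    simp_rw [hTe]
    exact hasLaplace_of_stieltjesZeta hN hN_zero hconv
      (by rw [Complex.add_re, Complex.one_re]; linarith)
  have hbL : ∀ z : ℂ, 0 < z.re →
      IntegrableOn (fun u : ℝ => (b u : ℂ) * Complex.exp (-z * u)) (Ioi 0) := fun z hz =>
    integrableOn_mul_cexp_of_bounded hbm hB hz
  have hsub : ∀ (z : ℂ) (u : ℝ), ((T u - b u : ℝ) : ℂ) * Complex.exp (-z * u) =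
      (T u : ℂ) * Complex.exp (-z * u) - (b u : ℂ) * Complex.exp (-z * u) := by
    intro z u; push_cast; ring
  have hHc := continuousOn_remainderLaplace hF.1 r θ
  have hΔi : ∀ z : ℂ, 0 < z.re →
      IntegrableOn (fun u : ℝ => ((T u - b u : ℝ) : ℂ) * Complex.exp (-z * u)) (Ioi 0) := by
    intro z hz
    simp_rw [hsub]
    exact (hTL z hz).1.sub (hbL z hz)
  have hΔL : ∀ z : ℂ, 0 < z.re → ∫ u in Ioi (0 : ℝ),
      ((T u - b u : ℝ) : ℂ) * Complex.exp (-z * u) = remainderLaplace F n r θ z := by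
    intro z hz
    simp_rw [hsub]
    rw [integral_sub (hTL z hz).1 (hbL z hz), (hTL z hz).2,
      integral_scaledMainTerm_mul_cexp n a r θ hz, stieltjesZeta_one_add_div hN hF hz]
  obtain ⟨M, hM⟩ := exists_bound_of_laplace_continuousOn hχ hc hKc hKi hK0 hKpos hK hHc
    (fun z hz => (hTL z hz).1) hbL hΔL hB hT0 hTslow
  have hM0 : 0 ≤ M := (hT0 1).trans (hM 1 one_pos)
  have hΔB : ∀ u > 0, |T u - b u| ≤ M + B := by
    intro u hu
    refine (abs_sub _ _).trans (add_le_add ?_ (hB u hu))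
    rw [abs_of_nonneg (hT0 u)]; exact hM u hu
  obtain ⟨-, C, hC0, hC⟩ := hasSmallOscillation_remainderLaplace hχ hc hβ hF.1 hgrowth r θ
  refine tauberian_decay (f := fun u => T u - b u) (B := M + B) (L := M + L) (C₁ := C * 2 ^ n)
    hKc hK0 hKpos hKi hγ0 (hKγ γ) (hTm.sub hbm) hΔB (by positivity) (by positivity) ?_ ?_
  -- Monotonicity gives `T u ≥ T x * e^{-(u-x)} ≥ T x * (1 - (u - x))`, so `T` loses at most `M (u -
  -- x)`, and the main term adds its Lipschitz constant `L`.
  · intro x hx u hu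
    have h1 := hTslow x u hu
    have h2 := (abs_le.mp (hL x hx u hu)).2
    have h3 := Real.add_one_le_exp (-(u - x))
    have h4 := hM x (by linarith)
    have h5 := hT0 x
    have h6 : T x * (-(u - x) + 1) ≤ T x * Real.exp (-(u - x)) := by gcongr
    have h7 : T x * (u - x) ≤ M * (u - x) := by
      have : 0 ≤ u - x := by linarith
      gcongr
    linarith
  · intro x hx y hy
    have hx0 : 0 < x := by linarith
    have hl : 1 ≤ x ^ γ := Real.one_le_rpow (by linarith) hγ0
    have hid := integral_mul_dilated_kernel_eq_boundary hχ hc hKc hKi hK hHc hΔi hΔL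
      (hTm.sub hbm) hΔB hl y
    have h1 := hC (x ^ γ) hl y (by linarith)
    rw [← hid, Complex.norm_real, Real.norm_eq_abs] at h1
    refine h1.trans ?_
    have h2 : (x / 2) ^ n ≤ y ^ n := by gcongr
    -- This is the balance `γ (1 + β) = n` behind the choice `l = x ^ γ`.
    have h3 : (x ^ γ) ^ β = x ^ (-γ) * x ^ n := by
      rw [← Real.rpow_mul hx0.le, ← Real.rpow_natCast x n, ← Real.rpow_add hx0]
      congr 1
      rw [hγ_def]
      field_simp
      ring
    have h4 : 0 ≤ x ^ (-γ) := by positivity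
    calc C * (x ^ γ) ^ β / y ^ n ≤ C * (x ^ γ) ^ β / (x / 2) ^ n := by gcongr
      _ = C * 2 ^ n * x ^ (-γ) := by rw [h3, div_pow]; field_simp

theorem mul_scaledMainTerm_log (n : ℕ) (a : ℝ) (r θ : ℕ → ℝ) {x : ℝ} (hx : Real.exp 1 ≤ x) :
    x * scaledMainTerm n a r θ (Real.log x) = a * x - a + 2 * x / Real.log x ^ (1 / 2 : ℝ) *
        ∑ j ∈ Finset.Icc 1 n, r j * Real.cos (Real.log x + θ j) /
          (Real.Gamma (-j + 1 / 2) * Real.log x ^ j) := by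
  have hx0 : 0 < x := (Real.exp_pos 1).trans_le hx
  have hu : 1 ≤ Real.log x := (Real.le_log_iff_exp_le hx0).mpr hx
  have hu0 : 0 < Real.log x := by linarith
  have e1 : x * (a * (1 - Real.exp (-Real.log x))) = a * x - a := by
    rw [Real.exp_neg, Real.exp_log hx0]; field_simp
  rw [scaledMainTerm, mul_add, e1, Finset.mul_sum, Finset.mul_sum]
  congr 1
  refine Finset.sum_congr rfl fun j _ => ?_
  have e2 : Real.log x ^ (-(j : ℝ) - 1 / 2) =
      (Real.log x ^ (1 / 2 : ℝ))⁻¹ * (Real.log x ^ j)⁻¹ := by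
    rw [← Real.rpow_natCast, ← Real.rpow_neg hu0.le, ← Real.rpow_neg hu0.le,
      ← Real.rpow_add hu0]
    congr 1; ring
  have hG := gamma_half_sub_ne_zero j
  rw [halfPowerWave, indicator_of_mem (show Real.log x ∈ Ici (1 : ℝ) from hu), e2]
  have h1 : Real.log x ^ (1 / 2 : ℝ) ≠ 0 := (Real.rpow_pos_of_pos hu0 _).ne'
  field_simp

end

theorem theorem5p1 (N : ℝ → ℝ) (hN : Monotone N) (hN_zero : ∀ x < 1, N x = 0)
    (hconv : StieltjesZetaConverges N hN)
    (n : ℕ) (a : ℝ) (ha : 0 ≤ a) (r θ : ℕ → ℝ)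
    (hr : ∀ j ∈ Finset.Icc 1 n, 0 ≤ r j)
    (hθ : ∀ j ∈ Finset.Icc 1 n, θ j ∈ Set.Ico 0 (2 * Real.pi))
    (β : ℝ) (hβ : 0 < β)
    (F : ℂ → ℂ) (hF : IsCnExtension n (zetaRemainder N hN n a r θ) F)
    (hgrowth : ∀ j ≤ n,
      (fun t : ℝ => iteratedDerivWithin j F closedHalfPlane (1 + t * Complex.I))
        =O[Filter.cocompact ℝ] fun t : ℝ => |t| ^ (β + n - j)) :
    (fun x : ℝ => N x - (a * x + 2 * x / Real.log x ^ (1 / 2 : ℝ) *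
        ∑ j ∈ Finset.Icc 1 n, r j * Real.cos (Real.log x + θ j) /
          (Real.Gamma (-j + 1 / 2) * Real.log x ^ j)))
      =O[Filter.atTop] fun x : ℝ => x / Real.log x ^ ((n : ℝ) / (1 + β)) := by
  obtain ⟨C, hC0, hC⟩ := exists_scaled_remainder_le hN hN_zero hconv n a r θ hβ F hF hgrowth
  refine Asymptotics.IsBigO.of_bound (C + a) ?_
  -- The leftover constant `a` fits into the error term, since this power of `log x` is eventually
  -- at most `x`.
  have hlog := (isLittleO_log_rpow_rpow_atTop ((n : ℝ) / (1 + β)) one_pos).bound one_pos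
  filter_upwards [hlog, Filter.eventually_ge_atTop (Real.exp 1)] with x hxlog hx
  have hx0 : 0 < x := (Real.exp_pos 1).trans_le hx
  have hu : 1 ≤ Real.log x := (Real.le_log_iff_exp_le hx0).mpr hx
  have hu0 : 0 < Real.log x := by linarith
  have hp : 0 < Real.log x ^ ((n : ℝ) / (1 + β)) := Real.rpow_pos_of_pos hu0 _
  have h1 := hC _ hu
  rw [Real.exp_log hx0, Real.exp_neg, Real.exp_log hx0, Real.rpow_neg hu0.le] at h1
  have e : N x - (a * x + 2 * x / Real.log x ^ (1 / 2 : ℝ) *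
        ∑ j ∈ Finset.Icc 1 n, r j * Real.cos (Real.log x + θ j) /
          (Real.Gamma (-j + 1 / 2) * Real.log x ^ j)) =
      x * (N x * x⁻¹ - scaledMainTerm n a r θ (Real.log x)) - a := by
    rw [mul_sub, mul_scaledMainTerm_log n a r θ hx]
    field_simp
    ring
  rw [Real.norm_of_nonneg hp.le, Real.rpow_one, Real.norm_of_nonneg hx0.le, one_mul] at hxlog
  rw [e, Real.norm_eq_abs, Real.norm_of_nonneg (by positivity)]
  have h2 : 1 ≤ x / Real.log x ^ ((n : ℝ) / (1 + β)) := (one_le_div hp).mpr hxlog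
  calc |x * (N x * x⁻¹ - scaledMainTerm n a r θ (Real.log x)) - a|
      ≤ |x * (N x * x⁻¹ - scaledMainTerm n a r θ (Real.log x))| + |a| := abs_sub _ _
    _ ≤ x * (C * (Real.log x ^ ((n : ℝ) / (1 + β)))⁻¹) +
        a * (x / Real.log x ^ ((n : ℝ) / (1 + β))) := by
        rw [abs_mul, abs_of_pos hx0, abs_of_nonneg ha]
        gcongr
        exact le_mul_of_one_le_right ha h2
    _ = _ := by rw [div_eq_mul_inv]; ring
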